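/- **Problem.** Let $T$ be a compact metric space, $\mu>0$, $f:\mathbb R^n\to\mathbb R$ continuously differentiable, $g:\mathbb R^n\times T\to\mathbb R$ continuous with $g(\cdot,\tau)$ convex and continuously differentiable for every $\tau\in T$, $F(x)=F_0+\sum_{i=1}^n x_iF_i$ with $F_0,\dots,F_n\in S^m$ (real symmetric $m\times m$ matrices), $G\in\mathbb R^{s\times n}$, $h\in\mathbb R^s$. Consider the SIPLOG $$\min_x\ f(x)-\mu\log\det F(x)\quad\text{s.t. } g(x,\tau)\le 0\ (\tau\in T),\ F(x)\in S^m_{++},\ Gx=h,$$ and assume that it has a Slater point: some $\bar x$ with $F(\bar x)\in S^m_{++}$, $g(\bar x,\tau)<0$ for all $\tau\in T$, and $G\bar x=h$. Let $\mathcal M(T)$ be the space of finite signed Borel measures on $T$ (the dual of $\mathcal C(T)$) with norm $\|y\|=\sup_A y(A)-\inf_A y(A)$ over Borel sets $A$, $\mathcal M_+(T)$ its nonnegative elements, and $\mathrm{supp}(y)=\{\tau: y(\{\tau\})\ne0\}$. Write $X\circ Y=(XY+YX)/2$, $X\bullet Y=\mathrm{Tr}(XY)$, $\mathcal L_X(Z)=X\circ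 Z$ on $S^m$, $(a)_+=\max(a,0)$. A point $(x,y,z,V)\in\mathbb R^n\times\mathcal M(T)\times\mathbb R^s\times S^m$ is a *KKT point* if * (e1) $\nabla f(x)+\int_T\nabla_xg(x,\tau)\,dy(\tau)-(F_i\bullet V)_{i=1}^n+G^\top z=0$; * (e2) $F(x)\circ V=\mu I$, $F(x)\in S^m_{++}$, $V\in S^m_{++}$; * (e3) $\int_Tg(x,\tau)\,dy(\tau)=0$, $g(x,\tau)\le0$ $(\tau\in T)$, $y\in\mathcal M_+(T)$; * (e4) $Gx=h$. **Algorithm 1.** Fix $\alpha,\beta_1,\beta_2,\sigma\in(0,1)$ and $\delta,\nu,\rho_0,\gamma_0>0$. Start from $x^0\in\mathbb R^n$ with $F(x^0)\in S^m_{++}$, a finitely supported discrete $y^0\in\mathcal M_+(T)$, $z^0\in\mathbb R^s$, $V_0\in S^m_{++}$. For $r=0,1,2,\dots$: 1. Choose a nonsingular $P_r\in\mathbb R^{m\times m}$ and a positive definite $B_r\in S^n$. 2. Find $\Delta x^r\in\mathbb R^n$, a finitely supported discrete $y^{r+1}\in\mathcal M_+(T)$ and $z^{r+1}\in\mathbb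 R^s$ such that, with $x=x^r$, $\Delta x=\Delta x^r$, $\xi(x)=(F_i\bullet F(x)^{-1})_{i=1}^n$ and $l(\tau)=g(x,\tau)+\nabla_xg(x,\tau)^\top\Delta x$: $\ \nabla f(x)+B_r\Delta x-\mu\xi(x)+\int_T\nabla_xg(x,\tau)\,dy^{r+1}(\tau)+G^\top z^{r+1}=0$; $\ l(\tau)\le0$ for $\tau\in\mathrm{supp}(y^{r+1})$; $\ \int_T l\,dy^{r+1}=0$; $\ G(x+\Delta x)=h$; $\ \max_{\tau\in T}(l(\tau))_+\le\gamma_r$. 3. With $\tilde F=P_rF(x^r)P_r^\top$, $\tilde F_i=P_rF_iP_r^\top$, $\tilde V=P_r^{-\top}V_rP_r^{-1}$, set $\Delta V_r=\mu F(x^r)^{-1}-V_r-\sum_{i=1}^n\Delta x^r_i\,P_r^\top\big(\mathcal L_{\tilde F}^{-1}\mathcal L_{\tilde V}\tilde F_i\big)P_r$. 4. If $\rho_r>\max(\|y^{r+1}\|,\|z^{r+1}\|_\infty)$ set $\rho_{r+1}=\rho_r$; otherwise set $\rho_{r+1}=\delta+\max(\|y^{r+1}\|,\|z^{r+1}\|_\infty)$.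 5. Let $\bar s=\min(s_x,s_V,1)$, where $s_x=-\sigma/\lambda_{\min}(M)$ if $\lambda_{\min}(M)<0$ and $s_x=1$ otherwise, with $M=F(x^r)^{-1}\sum_i\Delta x_i^rF_i$, and $s_V$ is defined in the same way with $M=V_r^{-1}\Delta V_r$. Set $s_r=\bar s\beta_1^{\ell}$ for the smallest integer $\ell\ge0$ with $$\Phi_{\rho_{r+1}}(x^r+s_r\Delta x^r,V_r+s_r\Delta V_r)\le\Phi_{\rho_{r+1}}(x^r,V_r)-\alpha s_r\Delta\Phi_r+\rho_{r+1}s_r\gamma_r,$$ where $\Delta\Phi_r=(\Delta x^r)^\top B_r\Delta x^r-\nu\psi'(x^r,V_r;\Delta x^r,\Delta V_r)$, $\Phi_\rho(x,V)=f(x)-\mu\log\det F(x)+\rho\max_{\tau\in T}(g(x,\tau))_++\rho\|Gx-h\|_1+\nu\psi(x,V)$, $\psi(x,V)=F(x)\bullet V-\mu\log\det(F(x)V)$, and $\psi'(x,V;\Delta x,\Delta V)=\mathrm{Tr}\big(\sum_i\Delta x_iF_iV+F(x)\Delta V-\mu F(x)^{-1}\sum_i\Delta x_iF_i-\mu V^{-1}\Delta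 V\big)$. 6. Set $(x^{r+1},V_{r+1})=(x^r+s_r\Delta x^r,V_r+s_r\Delta V_r)$ and $\gamma_{r+1}=\beta_2\gamma_r$. (The algorithm stops when $(x^r,y^r,z^r,V_r)$ is a KKT point; the theorem concerns infinite sequences generated by steps 1–6, whether or not some iterate is a KKT point.) **Assumption A.** (i) For every $r$, $P_r=F(x^r)^{-1/2}$ (HRVW/KSH/M scaling) or $P_r=W_r^{-1/2}$ with $W_r=F(x^r)^{1/2}\big(F(x^r)^{1/2}V_rF(x^r)^{1/2}\big)^{-1/2}F(x^r)^{1/2}$ (NT scaling); (ii) $\{\rho_r\}$ is bounded; (iii) $\{x^r\}$ is bounded; (iv) $Gx^0=h$. **Assumption B.** There are $\eta_2>\eta_1>0$ with $\eta_2I\succeq B_r\succeq\eta_1I$ for all $r$. **Theorem.** Under Assumptions A and B, the sequence $\{(x^r,y^r,z^r,V_r)\}$ is bounded, and every accumulation point $(x^*,y^*,z^*,V_*)\in\mathbb R^n\times\mathcal M(T)\times\mathbb R^s\times S^m$ of it, with respect to the weak* topology on $\mathcal M(T)$ and the usual topologies on the other factors, is a KKT point of the SIPLOG. -/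

import Mathlib

open MeasureTheory Filter Topology
open scoped Matrix

noncomputable section

namespace SIPLOG

/-- `ℝⁿ` with its Euclidean structure. -/
abbrev Vec (n : ℕ) : Type := EuclideanSpace ℝ (Fin n)

/-- Real `m × m` matrices; symmetry and definiteness are imposed where they are needed. -/
abbrev Mat (m : ℕ) : Type := Matrix (Fin m) (Fin m) ℝ

/-! ### Matrices -/

/-- Jordan product `X ∘ Y = (XY + YX) / 2`. -/
def jordan {m : ℕ} (X Y : Mat m) : Mat m := (2⁻¹ : ℝ) • (X * Y + Y * X)

/-- Inner product `X • Y = Tr (XY)`. -/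
def inn {m : ℕ} (X Y : Mat m) : ℝ := (X * Y).trace

/-- Frobenius norm. -/
def frobNorm {m : ℕ} (X : Mat m) : ℝ := Real.sqrt (Xᵀ * X).trace

/-- `R = A ^ (1/2)`, the positive semidefinite square root. -/
def IsSqrt {m : ℕ} (R A : Mat m) : Prop := R.PosSemidef ∧ R * R = A

/-- `P = A ^ (-1/2)` for positive definite `A`. -/
def IsInvSqrt {m : ℕ} (P A : Mat m) : Prop := ∃ R : Mat m, IsSqrt R A ∧ P = R⁻¹

/-- HRVW/KSH/M matrix: `P = Fx ^ (-1/2)`. -/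
def IsHRVW {m : ℕ} (P Fx : Mat m) : Prop := IsInvSqrt P Fx

/-- NT matrix: `P = W ^ (-1/2)`, where
`W = Fx ^ (1/2) (Fx ^ (1/2) V Fx ^ (1/2)) ^ (-1/2) Fx ^ (1/2)`. -/
def IsNT {m : ℕ} (P Fx V : Mat m) : Prop :=
  ∃ R Q : Mat m, IsSqrt R Fx ∧ IsInvSqrt Q (R * V * R) ∧ IsInvSqrt P (R * Q * R)

/-- Smallest real eigenvalue of a square matrix. It is used for products of two symmetric matrices
one of which is positive definite, all of whose eigenvalues are real. -/
def lambdaMin {m : ℕ} (A : Mat m) : ℝ := sInf (spectrum ℝ A)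

/-- `-σ / λ_min(A)` if `λ_min(A) < 0`, and `1` otherwise. -/
def stepBound {m : ℕ} (σ : ℝ) (A : Mat m) : ℝ :=
  if lambdaMin A < 0 then -(σ / lambdaMin A) else 1

/-! ### The space `M(T)` of finite signed Borel measures -/

/-- Total variation norm `‖y‖ = sup_A y(A) - inf_A y(A)` over the measurable sets `A`. -/
def tvNorm {T : Type*} [MeasurableSpace T] (y : SignedMeasure T) : ℝ :=
  sSup {t : ℝ | ∃ A : Set T, MeasurableSet A ∧ y A = t}
    - sInf {t : ℝ | ∃ A : Set T, MeasurableSet A ∧ y A = t}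

/-- `supp y = {τ | y {τ} ≠ 0}`. -/
def supp {T : Type*} [MeasurableSpace T] (y : SignedMeasure T) : Set T := {τ | y {τ} ≠ 0}

/-- A nonnegative discrete measure with finitely many atoms: `y ∈ M₊(T)`, `supp y` is finite, and
`y` is carried by `supp y`. -/
def IsFinitelySupported {T : Type*} [MeasurableSpace T] (y : SignedMeasure T) : Prop :=
  0 ≤ y ∧ (supp y).Finite ∧ y (supp y)ᶜ = 0

/-- The functional `φ ↦ ∫ φ dy` on `C(T)` given by `y`. The topology of `C(T, ℝ) → ℝ` is that of
pointwise convergence, so the topology which this map induces on `M(T)` is the weak* topology. -/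
def weakStar {T : Type*} [TopologicalSpace T] [MeasurableSpace T] (y : SignedMeasure T) :
    C(T, ℝ) → ℝ := fun φ => ∫ᵛ τ, φ τ ∂<•y

/-! ### The optimization problem -/

/-- Data of the problem: minimize `f x - μ log det F(x)` subject to `g(x, τ) ≤ 0` for all `τ ∈ T`,
`F(x)` positive definite, and `G x = h`, where `F(x) = F₀ + ∑ i, x i • F i`. -/
structure Problem (n m s : ℕ) (T : Type*) [TopologicalSpace T] where
  mu : ℝ
  f : Vec n → ℝ
  g : Vec n → T → ℝ
  F0 : Mat m
  Fi : Fin n → Mat m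
  G : Matrix (Fin s) (Fin n) ℝ
  h : Fin s → ℝ
  mu_pos : 0 < mu
  f_contDiff : ContDiff ℝ 1 f
  g_continuous : Continuous (fun q : Vec n × T => g q.1 q.2)
  g_convex : ∀ τ, ConvexOn ℝ Set.univ (fun x => g x τ)
  g_contDiff : ∀ τ, ContDiff ℝ 1 (fun x => g x τ)
  F0_symm : F0.IsSymm
  Fi_symm : ∀ i, (Fi i).IsSymm

namespace Problem

variable {n m s : ℕ} {T : Type*} [TopologicalSpace T] (p : Problem n m s T)

/-- The linear part `∑ i, d i • F i`. -/
def dF (d : Vec n) : Mat m := ∑ i, d i • p.Fi i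

/-- `F(x) = F₀ + ∑ i, x i • F i`. -/
def F (x : Vec n) : Mat m := p.F0 + p.dF x

/-- `∇ₓ g(x, τ)`. -/
def gradG (x : Vec n) (τ : T) : Vec n := gradient (fun x' => p.g x' τ) x

/-- `g(x, τ) + ∇ₓ g(x, τ)ᵀ d`. -/
def linG (x d : Vec n) (τ : T) : ℝ := p.g x τ + inner ℝ (p.gradG x τ) d

/-- The vector `(F_i • X)_i`. -/
def adjF (X : Mat m) : Vec n := WithLp.toLp 2 fun i => inn (p.Fi i) X

/-- `G x`. -/
def mulG (x : Vec n) : Fin s → ℝ := p.G *ᵥ x.ofLp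

/-- `Gᵀ z`. -/
def mulGT (z : Fin s → ℝ) : Vec n := WithLp.toLp 2 (p.Gᵀ *ᵥ z)

/-- `ξ(x) = ∇ log det F(x) = (F_i • F(x)⁻¹)_i`. -/
def xi (x : Vec n) : Vec n := p.adjF (p.F x)⁻¹

/-- Existence of a Slater point. -/
def HasSlaterPoint : Prop :=
  ∃ x : Vec n, (p.F x).PosDef ∧ (∀ τ, p.g x τ < 0) ∧ p.mulG x = p.h

/-- KKT points `(x, y, z, V)` of the problem. -/
structure IsKKT [MeasurableSpace T] (x : Vec n) (y : SignedMeasure T) (z : Fin s → ℝ)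
    (V : Mat m) : Prop where
  stationarity :
    gradient p.f x + (∫ᵛ τ, p.gradG x τ ∂<•y) - p.adjF V + p.mulGT z = 0
  barrier : jordan (p.F x) V = p.mu • (1 : Mat m)
  F_posDef : (p.F x).PosDef
  V_posDef : V.PosDef
  complementarity : ∫ᵛ τ, p.g x τ ∂<•y = 0
  feasible : ∀ τ, p.g x τ ≤ 0
  y_nonneg : 0 ≤ y
  equality : p.mulG x = p.h

/-- `max_{τ ∈ T} (g(x, τ))₊`. -/
def theta (x : Vec n) : ℝ := ⨆ τ, max (p.g x τ) 0

/-- `χ_ρ(x) = f(x) - μ log det F(x) + ρ max_τ (g(x, τ))₊ + ρ ‖G x - h‖₁`. -/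
def chi (ρ : ℝ) (x : Vec n) : ℝ :=
  p.f x - p.mu * Real.log (p.F x).det + ρ * p.theta x + ρ * ∑ j, |p.mulG x j - p.h j|

/-- `ψ(x, V) = F(x) • V - μ log det (F(x) V)`. -/
def psi (x : Vec n) (V : Mat m) : ℝ :=
  inn (p.F x) V - p.mu * Real.log (p.F x * V).det

/-- Directional derivative `ψ'(x, V; d, D)`. -/
def psiDeriv (x : Vec n) (V : Mat m) (d : Vec n) (D : Mat m) : ℝ :=
  (p.dF d * V + p.F x * D - p.mu • ((p.F x)⁻¹ * p.dF d) - p.mu • (V⁻¹ * D)).trace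

/-- Merit function `Φ_ρ(x, V) = χ_ρ(x) + ν ψ(x, V)`. -/
def merit (ν ρ : ℝ) (x : Vec n) (V : Mat m) : ℝ := p.chi ρ x + ν * p.psi x V

/-- `d`, `y` and `z` satisfy the relaxed optimality conditions, with tolerance `γ`, of the
semi-infinite quadratic program at `x` with coefficient matrix `B`. -/
structure IsDirection [MeasurableSpace T] (x : Vec n) (B : Mat n) (γ : ℝ) (d : Vec n)
    (y : SignedMeasure T) (z : Fin s → ℝ) : Prop where
  y_supp : IsFinitelySupported y
  stationarity :
    gradient p.f x + WithLp.toLp 2 (B *ᵥ d.ofLp) - p.mu • p.xi x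
      + (∫ᵛ τ, p.gradG x τ ∂<•y) + p.mulGT z = 0
  feasible_supp : ∀ τ ∈ supp y, p.linG x d τ ≤ 0
  complementarity : ∫ᵛ τ, p.linG x d τ ∂<•y = 0
  equality : p.mulG (x + d) = p.h
  relaxed : ∀ τ, max (p.linG x d τ) 0 ≤ γ

/-- `D = μ F(x)⁻¹ - V - ∑ i, d i • Pᵀ (L⁻¹ L' F̃_i) P`, where `F̃(x) = P F(x) Pᵀ`,
`F̃_i = P F_i Pᵀ`, `Ṽ = P⁻ᵀ V P⁻¹`, and `L`, `L'` are the Jordan multiplications by `F̃(x)` and `Ṽ` on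
the symmetric matrices. The matrix `U i` is `L⁻¹ L' F̃_i`: the symmetric solution of
`F̃(x) ∘ U = Ṽ ∘ F̃_i`, which is unique when `F(x)` is positive definite and `P` is nonsingular. -/
def IsDeltaV (x : Vec n) (V P : Mat m) (d : Vec n) (D : Mat m) : Prop :=
  ∃ U : Fin n → Mat m,
    (∀ i, (U i).IsSymm ∧
      jordan (P * p.F x * Pᵀ) (U i) = jordan ((P⁻¹)ᵀ * V * P⁻¹) (P * p.Fi i * Pᵀ)) ∧
    D = p.mu • (p.F x)⁻¹ - V - ∑ i, d i • (Pᵀ * U i * P)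

/-- Initial trial step size `min (s_x, s_V, 1)`. -/
def initialStep (σ : ℝ) (x : Vec n) (V : Mat m) (d : Vec n) (D : Mat m) : ℝ :=
  min (min (stepBound σ ((p.F x)⁻¹ * p.dF d)) (stepBound σ (V⁻¹ * D))) 1

/-- Armijo-like condition for the step size `t`. -/
def Armijo (α ν ρ γ : ℝ) (x : Vec n) (V : Mat m) (B : Mat n) (d : Vec n) (D : Mat m)
    (t : ℝ) : Prop :=
  p.merit ν ρ (x + t • d) (V + t • D) ≤
    p.merit ν ρ x V
      - α * t * (d.ofLp ⬝ᵥ (B *ᵥ d.ofLp) - ν * p.psiDeriv x V d D) + ρ * t * γ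

end Problem

/-! ### The algorithm -/

/-- Parameters of the algorithm. -/
structure Params where
  α : ℝ
  β₁ : ℝ
  β₂ : ℝ
  σ : ℝ
  δ : ℝ
  ν : ℝ
  ρ₀ : ℝ
  γ₀ : ℝ
  α_mem : α ∈ Set.Ioo (0 : ℝ) 1
  β₁_mem : β₁ ∈ Set.Ioo (0 : ℝ) 1
  β₂_mem : β₂ ∈ Set.Ioo (0 : ℝ) 1
  σ_mem : σ ∈ Set.Ioo (0 : ℝ) 1
  δ_pos : 0 < δ
  ν_pos : 0 < ν
  ρ₀_pos : 0 < ρ₀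
  γ₀_pos : 0 < γ₀

/-- An infinite run of the interior point SQP-type algorithm. The stopping test, which only ends a
run at a KKT point, is not imposed: a run may pass through KKT points. -/
structure Run {n m s : ℕ} {T : Type*} [TopologicalSpace T] [MeasurableSpace T]
    (p : Problem n m s T) (c : Params) where
  x : ℕ → Vec n
  y : ℕ → SignedMeasure T
  z : ℕ → Fin s → ℝ
  V : ℕ → Mat m
  P : ℕ → Mat m
  B : ℕ → Mat n
  dx : ℕ → Vec n
  dV : ℕ → Mat m
  ρ : ℕ → ℝ
  γ : ℕ → ℝ
  ℓ : ℕ → ℕ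
  step : ℕ → ℝ
  -- initialization
  F_x_zero : (p.F (x 0)).PosDef
  V_zero : (V 0).PosDef
  y_zero : IsFinitelySupported (y 0)
  ρ_zero : ρ 0 = c.ρ₀
  γ_zero : γ 0 = c.γ₀
  -- scaling and coefficient matrices
  P_isUnit : ∀ r, IsUnit (P r)
  B_posDef : ∀ r, (B r).PosDef
  -- search direction and Lagrange multipliers
  direction : ∀ r, p.IsDirection (x r) (B r) (γ r) (dx r) (y (r + 1)) (z (r + 1))
  deltaV : ∀ r, p.IsDeltaV (x r) (V r) (P r) (dx r) (dV r)
  -- penalty parameter; the norm of `Fin s → ℝ` is the maximum norm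
  ρ_succ : ∀ r, ρ (r + 1) =
    if ρ r > max (tvNorm (y (r + 1))) ‖z (r + 1)‖ then ρ r
    else c.δ + max (tvNorm (y (r + 1))) ‖z (r + 1)‖
  -- line search
  ℓ_least : ∀ r, IsLeast
    {l : ℕ | p.Armijo c.α c.ν (ρ (r + 1)) (γ r) (x r) (V r) (B r) (dx r) (dV r)
      (p.initialStep c.σ (x r) (V r) (dx r) (dV r) * c.β₁ ^ l)} (ℓ r)
  step_eq : ∀ r, step r = p.initialStep c.σ (x r) (V r) (dx r) (dV r) * c.β₁ ^ ℓ r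
  -- update
  x_succ : ∀ r, x (r + 1) = x r + step r • dx r
  V_succ : ∀ r, V (r + 1) = V r + step r • dV r
  γ_succ : ∀ r, γ (r + 1) = c.β₂ * γ r

namespace Run

variable {n m s : ℕ} {T : Type*} [TopologicalSpace T] [MeasurableSpace T]
  {p : Problem n m s T} {c : Params} (R : Run p c)

/-- Assumption A. -/
structure AssumptionA : Prop where
  scaling : ∀ r, IsHRVW (R.P r) (p.F (R.x r)) ∨ IsNT (R.P r) (p.F (R.x r)) (R.V r)
  penalty_bdd : ∃ M : ℝ, ∀ r, |R.ρ r| ≤ M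
  x_bdd : ∃ M : ℝ, ∀ r, ‖R.x r‖ ≤ M
  x_zero : p.mulG (R.x 0) = p.h

/-- Assumption B: `η₂ I ⪰ B_r ⪰ η₁ I` for all `r`, for some `η₂ > η₁ > 0`. -/
def AssumptionB : Prop :=
  ∃ η₁ η₂ : ℝ, 0 < η₁ ∧ η₁ < η₂ ∧
    ∀ r, (η₂ • (1 : Mat n) - R.B r).PosSemidef ∧ (R.B r - η₁ • (1 : Mat n)).PosSemidef

end Run

end SIPLOG

end

/-!
Convergence of the interior point SQP-type method for semi-infinite programs with a log-determinant
term.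

The penalty parameter grows by at least `δ` whenever it changes, so boundedness makes it eventually
constant and bounds the multipliers (`Run.eventually_ρ_eq`, `Run.max_le_ρ_succ`).

For both scalings the derivative of the primal-dual function `ψ` along the Newton direction is
`-tr (F (V - μ F⁻¹) V⁻¹ (V - μ F⁻¹))`, whatever the primal direction is (`Problem.psiDeriv_eq`).
It is nonpositive and vanishes only at `V = μ F⁻¹`. Hence the predicted decrease `ΔΦ_r` is
nonnegative. As the relaxation terms `γ_r` are summable and the merit function is bounded below on
bounded sets, `s_r ΔΦ_r → 0` and the merit values are bounded above
(`Run.AssumptionA.tendsto_step_mul_decrease`). The latter keeps `F(x^r)` and `V_r` in a compact set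
of positive definite matrices (`Run.AssumptionA.exists_det_trace_bounds`).

The core is `ΔΦ_r → 0` (`Run.AssumptionA.tendsto_decrease`). If it fails, then `ΔΦ_r` is bounded
below along some ultrafilter, so `s_r → 0` along it. All data converge along the ultrafilter and the
initial trial steps stay away from zero; therefore the trial step `s_r / β₁` was rejected, while it
tends to zero. A first-order estimate of the merit function (`Problem.merit_add_smul_le`), whose
remainder tends to zero (`Problem.tendsto_remainder`), contradicts the rejection. The estimate
needs no derivative of `log det`: concavity, in the form `log det X ≤ tr X - m`, is enough, and the
constraint functions are handled by the convex gradient inequality together with the joint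
continuity of their gradients (`continuous_inner_gradient_of_convexOn`).

So `Δx^r → 0` and `V_r - μ F(x^r)⁻¹ → 0`, and the optimality conditions of the quadratic programs
pass to the limit: `∇ₓ g(x^r, ·)` converges uniformly on `T` and the multiplier measures converge
weakly* (`tendsto_integral_of_weakStar`). The multipliers with index `r` belong to the iterate
`r - 1`, which has the same limit because `Δx^r → 0`. The limit measure is nonnegative because its
pairing with nonnegative continuous functions is (`nonneg_of_weakStar_nonneg`).
-/

/-! ### Positive definite matrices -/

namespace Matrix

variable {ι : Type*} [Fintype ι] [DecidableEq ι]

theorem PosSemidef.exists_transpose_mul_self {A : Matrix ι ι ℝ} (hA : A.PosSemidef) :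
    ∃ C : Matrix ι ι ℝ, A = Cᵀ * C := by
  open scoped MatrixOrder in
  obtain ⟨C, hC⟩ := CStarAlgebra.nonneg_iff_eq_star_mul_self.mp hA.nonneg
  exact ⟨C, by simpa [star_eq_conjTranspose] using hC⟩

theorem PosDef.exists_transpose_mul_self {A : Matrix ι ι ℝ} (hA : A.PosDef) :
    ∃ C : Matrix ι ι ℝ, IsUnit C.det ∧ A = Cᵀ * C := by
  obtain ⟨C, hC⟩ := hA.posSemidef.exists_transpose_mul_self
  refine ⟨C, ?_, hC⟩
  have h := hA.det_pos
  rw [hC, det_mul, det_transpose] at h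
  exact isUnit_iff_ne_zero.2 fun h0 => by simp [h0] at h

theorem PosDef.isUnit_det {A : Matrix ι ι ℝ} (hA : A.PosDef) : IsUnit A.det :=
  isUnit_iff_ne_zero.2 hA.det_pos.ne'

omit [Fintype ι] [DecidableEq ι] in
theorem PosDef.isSymm {A : Matrix ι ι ℝ} (hA : A.PosDef) : A.IsSymm := by
  simpa [IsHermitian, IsSymm] using hA.1

omit [Fintype ι] [DecidableEq ι] in
theorem PosSemidef.isSymm {A : Matrix ι ι ℝ} (hA : A.PosSemidef) : A.IsSymm := by
  simpa [IsHermitian, IsSymm] using hA.1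

omit [Fintype ι] [DecidableEq ι] in
theorem isHermitian_of_isSymm {A : Matrix ι ι ℝ} (hA : A.IsSymm) : A.IsHermitian := by
  simpa [IsHermitian, IsSymm] using hA

omit [DecidableEq ι] in
theorem PosSemidef.mul_mul_transpose {A : Matrix ι ι ℝ} (hA : A.PosSemidef) (C : Matrix ι ι ℝ) :
    (C * A * Cᵀ).PosSemidef := by
  simpa using hA.mul_mul_conjTranspose_same C

theorem PosDef.mul_mul_transpose {A : Matrix ι ι ℝ} (hA : A.PosDef) {C : Matrix ι ι ℝ}
    (hC : IsUnit C.det) : (C * A * Cᵀ).PosDef := by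
  rw [(hA.posSemidef.mul_mul_transpose C).posDef_iff_det_ne_zero, det_mul, det_mul, det_transpose]
  exact mul_ne_zero (mul_ne_zero hC.ne_zero hA.det_pos.ne') hC.ne_zero

/-- `log λ ≤ λ - 1`, summed over the eigenvalues. -/
theorem PosDef.log_det_le {A : Matrix ι ι ℝ} (hA : A.PosDef) :
    Real.log A.det ≤ A.trace - Fintype.card ι := by
  rw [hA.1.det_eq_prod_eigenvalues, hA.1.trace_eq_sum_eigenvalues]
  simp only [RCLike.ofReal_real_eq_id, id_eq]
  rw [Real.log_prod fun i _ => (hA.eigenvalues_pos i).ne']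
  calc _ ≤ ∑ i, (hA.1.eigenvalues i - 1) :=
        Finset.sum_le_sum fun i _ => Real.log_le_sub_one_of_pos (hA.eigenvalues_pos i)
    _ = _ := by simp

theorem PosDef.log_det_mul_le {A B : Matrix ι ι ℝ} (hA : A.PosDef) (hB : B.PosDef) :
    Real.log (A * B).det ≤ (A * B).trace - Fintype.card ι := by
  obtain ⟨C, hC, rfl⟩ := hA.exists_transpose_mul_self
  have h := (hB.mul_mul_transpose hC).log_det_le
  have h1 : (C * B * Cᵀ).det = (Cᵀ * C * B).det := by simp only [det_mul]; ring
  have h2 : (C * B * Cᵀ).trace = (Cᵀ * C * B).trace := by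
    rw [trace_mul_comm, ← Matrix.mul_assoc]
  rwa [h1, h2] at h

theorem PosDef.log_det_mul {A B : Matrix ι ι ℝ} (hA : A.PosDef) (hB : B.PosDef) :
    Real.log (A * B).det = Real.log A.det + Real.log B.det := by
  rw [det_mul, Real.log_mul hA.det_pos.ne' hB.det_pos.ne']

/-- The gradient inequality of the concave function `log det`, at the second point. -/
theorem PosDef.le_log_det_add_sub {A E : Matrix ι ι ℝ} {t : ℝ} (hA : A.PosDef)
    (hAE : (A + t • E).PosDef) :
    t * ((A + t • E)⁻¹ * E).trace ≤ Real.log (A + t • E).det - Real.log A.det := by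
  have h := hAE.inv.log_det_mul_le hA
  have h1 : (A + t • E)⁻¹ * A = 1 - t • ((A + t • E)⁻¹ * E) := by
    have : (A + t • E)⁻¹ * (A + t • E) = 1 := nonsing_inv_mul _ hAE.isUnit_det
    rw [Matrix.mul_add, Matrix.mul_smul] at this
    rw [← this]; abel
  rw [hAE.inv.log_det_mul hA, h1, trace_sub, trace_one, trace_smul, det_nonsing_inv,
    Ring.inverse_eq_inv', Real.log_inv, smul_eq_mul] at h
  linarith

theorem PosSemidef.trace_mul_mul_mul_nonneg {A B X : Matrix ι ι ℝ} (hA : A.PosSemidef)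
    (hB : B.PosSemidef) (hX : X.IsSymm) : 0 ≤ (A * X * B * X).trace := by
  obtain ⟨C, rfl⟩ := hA.exists_transpose_mul_self
  have h := (hB.mul_mul_transpose (C * X)).trace_nonneg
  rw [transpose_mul, hX.eq] at h
  have h1 : (Cᵀ * C * X * B * X).trace = (C * X * B * (X * Cᵀ)).trace := by
    rw [← Matrix.mul_assoc, trace_mul_comm _ Cᵀ]
    simp only [Matrix.mul_assoc]
  rwa [h1]

theorem PosDef.eq_zero_of_trace_mul_mul_mul {A B X : Matrix ι ι ℝ} (hA : A.PosDef)
    (hB : B.PosDef) (hX : X.IsSymm) (h0 : (A * X * B * X).trace = 0) : X = 0 := by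
  obtain ⟨C, hC, rfl⟩ := hA.exists_transpose_mul_self
  obtain ⟨K, hK, rfl⟩ := hB.exists_transpose_mul_self
  have h1 : ((K * X * Cᵀ)ᵀ * (K * X * Cᵀ)).trace = 0 := by
    rw [← h0]
    simp only [transpose_mul, hX.eq, transpose_transpose, Matrix.mul_assoc]
    rw [trace_mul_comm Cᵀ]
    simp only [Matrix.mul_assoc]
  rw [← conjTranspose_eq_transpose_of_trivial (K * X * Cᵀ),
    trace_conjTranspose_mul_self_eq_zero_iff] at h1
  have hCT : IsUnit (Cᵀ).det := by rwa [det_transpose]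
  have h2 : K * X = 0 := by
    rw [← Matrix.mul_nonsing_inv_cancel_right (A := Cᵀ) (K * X) hCT, h1, Matrix.zero_mul]
  rw [← Matrix.nonsing_inv_mul_cancel_left (A := K) X hK, h2, Matrix.mul_zero]

theorem PosSemidef.abs_apply_le_trace {A : Matrix ι ι ℝ} (hA : A.PosSemidef) (i j : ι) :
    |A i j| ≤ A.trace := by
  obtain ⟨C, rfl⟩ := hA.exists_transpose_mul_self
  have hd : ∀ i, (Cᵀ * C) i i = ∑ k, C k i ^ 2 := fun i => by
    simp [mul_apply, sq]
  have hn : ∀ i, 0 ≤ (Cᵀ * C) i i := fun i => by rw [hd]; positivity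
  have hle : ∀ i, (Cᵀ * C) i i ≤ (Cᵀ * C).trace := fun i =>
    Finset.single_le_sum (f := fun i => (Cᵀ * C) i i) (fun k _ => hn k) (Finset.mem_univ i)
  have h2 : |(Cᵀ * C) i j| ≤ ((Cᵀ * C) i i + (Cᵀ * C) j j) / 2 := by
    rw [hd, hd, ← Finset.sum_add_distrib, Finset.sum_div, mul_apply]
    refine (Finset.abs_sum_le_sum_abs _ _).trans (Finset.sum_le_sum fun k _ => ?_)
    rw [transpose_apply, abs_mul]
    nlinarith [sq_nonneg (|C k i| - |C k j|), sq_abs (C k i), sq_abs (C k j)]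
  linarith [hle i, hle j]

theorem PosSemidef.trace_mul_le {A B : Matrix ι ι ℝ} (hA : A.PosSemidef) (hB : B.PosSemidef) :
    (A * B).trace ≤ (Fintype.card ι : ℝ) ^ 2 * (A.trace * B.trace) := by
  calc (A * B).trace = ∑ i, ∑ j, A i j * B j i := by simp [trace, mul_apply]
    _ ≤ ∑ _i : ι, ∑ _j : ι, A.trace * B.trace := by
        refine Finset.sum_le_sum fun i _ => Finset.sum_le_sum fun j _ => ?_
        refine (le_abs_self _).trans ?_
        rw [abs_mul]
        exact mul_le_mul (hA.abs_apply_le_trace i j) (hB.abs_apply_le_trace j i) (abs_nonneg _)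
          hA.trace_nonneg
    _ = _ := by simp [sq]; ring

/-- `tr (A X)` controls `X ⪰ 0` once `A⁻¹` is bounded. -/
theorem PosDef.trace_le_trace_inv_mul_trace {A X : Matrix ι ι ℝ} (hA : A.PosDef)
    (hX : X.PosSemidef) :
    X.trace ≤ (Fintype.card ι : ℝ) ^ 2 * (A⁻¹.trace * (A * X).trace) := by
  obtain ⟨C, hC, rfl⟩ := hA.exists_transpose_mul_self
  have hCT : IsUnit (Cᵀ).det := by rwa [det_transpose]
  have h := (posSemidef_conjTranspose_mul_self C⁻¹).trace_mul_le (hX.mul_mul_transpose C)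
  simp only [conjTranspose_eq_transpose_of_trivial] at h
  have h1 : ((C⁻¹)ᵀ * C⁻¹).trace = (Cᵀ * C)⁻¹.trace := by
    rw [trace_mul_comm, mul_inv_rev, transpose_nonsing_inv]
  have h2 : (C * X * Cᵀ).trace = (Cᵀ * C * X).trace := by
    rw [trace_mul_comm, ← Matrix.mul_assoc]
  have h3 : ((C⁻¹)ᵀ * C⁻¹ * (C * X * Cᵀ)).trace = X.trace := by
    rw [Matrix.mul_assoc (C⁻¹)ᵀ, Matrix.mul_assoc C, nonsing_inv_mul_cancel_left _ _ hC,
      trace_mul_comm, transpose_nonsing_inv, mul_nonsing_inv_cancel_right _ _ hCT]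
  rwa [h3, h1, h2] at h

theorem PosSemidef.posDef_of_det_pos {A : Matrix ι ι ℝ} (hA : A.PosSemidef) (h : 0 < A.det) :
    A.PosDef :=
  hA.posDef_iff_det_ne_zero.2 h.ne'

omit [DecidableEq ι] in
theorem isClosed_setOf_posSemidef : IsClosed {A : Matrix ι ι ℝ | A.PosSemidef} := by
  have : {A : Matrix ι ι ℝ | A.PosSemidef} =
      {A | Aᵀ = A} ∩ ⋂ v : ι → ℝ, {A | 0 ≤ v ⬝ᵥ (A *ᵥ v)} := by
    ext A
    simp [posSemidef_iff_dotProduct_mulVec, IsHermitian]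
  rw [this]
  refine (isClosed_eq (by fun_prop) continuous_id).inter (isClosed_iInter fun v => ?_)
  exact isClosed_le continuous_const (by fun_prop)

/-- Limits of positive definite matrices with determinants bounded away from zero. -/
theorem posDef_of_tendsto {α : Type*} {l : Filter α} [l.NeBot] {X : α → Matrix ι ι ℝ}
    {A : Matrix ι ι ℝ} {c : ℝ} (hX : Tendsto X l (𝓝 A)) (hpd : ∀ᶠ a in l, (X a).PosDef)
    (hc : 0 < c) (hdet : ∀ᶠ a in l, c ≤ (X a).det) : A.PosDef := by
  have h1 : A.PosSemidef :=
    isClosed_setOf_posSemidef.mem_of_tendsto hX (hpd.mono fun _ h => h.posSemidef)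
  have h2 : Tendsto (fun a => (X a).det) l (𝓝 A.det) :=
    (Continuous.matrix_det continuous_id).continuousAt.tendsto.comp hX
  exact h1.posDef_of_det_pos (hc.trans_le (ge_of_tendsto h2 hdet))

theorem tendsto_inv {α : Type*} {l : Filter α} {X : α → Matrix ι ι ℝ} {A : Matrix ι ι ℝ}
    (hX : Tendsto X l (𝓝 A)) (hA : IsUnit A.det) :
    Tendsto (fun a => (X a)⁻¹) l (𝓝 A⁻¹) := by
  have hd : Tendsto (fun a => (X a).det) l (𝓝 A.det) :=
    (Continuous.matrix_det continuous_id).continuousAt.tendsto.comp hX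
  have ha : Tendsto (fun a => (X a).adjugate) l (𝓝 A.adjugate) :=
    (Continuous.matrix_adjugate continuous_id).continuousAt.tendsto.comp hX
  simp only [inv_def, Ring.inverse_eq_inv']
  exact (hd.inv₀ hA.ne_zero).smul ha

/-! ### Spectrum and step lengths -/

/-- Gershgorin's theorem, in its crudest form. -/
theorem abs_le_of_mem_spectrum {A : Matrix ι ι ℝ} {C x : ℝ} (hC : ∀ i j, |A i j| ≤ C)
    (hx : x ∈ spectrum ℝ A) : |x| ≤ Fintype.card ι * C := by
  rw [← spectrum_toLin', ← Module.End.hasEigenvalue_iff_mem_spectrum] at hx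
  obtain ⟨k, hk⟩ := eigenvalue_mem_ball hx
  rw [Metric.mem_closedBall, Real.dist_eq] at hk
  have h1 : ∑ j, |A k j| = |A k k| + ∑ j ∈ Finset.univ.erase k, ‖A k j‖ := by
    rw [← Finset.add_sum_erase _ _ (Finset.mem_univ k)]; rfl
  have h2 : ∑ j, |A k j| ≤ Fintype.card ι * C := by
    simpa using Finset.sum_le_sum fun j (_ : j ∈ Finset.univ) => hC k j
  have h3 : |x| ≤ |x - A k k| + |A k k| := by simpa using abs_add_le (x - A k k) (A k k)
  linarith

/-- With `A = Cᵀ C`, the matrix `A⁻¹ E` is similar to the symmetric `N = C⁻ᵀ E C⁻¹`, and `A + t E` is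
congruent to `1 + t N`. -/
theorem PosDef.add_smul_of_spectrum {A E : Matrix ι ι ℝ} {t : ℝ} (hA : A.PosDef) (hE : E.IsSymm)
    (h : ∀ x ∈ spectrum ℝ (A⁻¹ * E), 0 < 1 + t * x) : (A + t • E).PosDef := by
  obtain ⟨C, hC, rfl⟩ := hA.exists_transpose_mul_self
  have hCT : IsUnit (Cᵀ).det := by rwa [det_transpose]
  set N : Matrix ι ι ℝ := (C⁻¹)ᵀ * E * C⁻¹ with hN
  have hNs : N.IsSymm := by
    simp only [IsSymm, hN, transpose_mul, transpose_transpose, hE.eq, Matrix.mul_assoc]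
  have hsp : spectrum ℝ N = spectrum ℝ ((Cᵀ * C)⁻¹ * E) := by
    let u : (Matrix ι ι ℝ)ˣ := ⟨C, C⁻¹, mul_nonsing_inv _ hC, nonsing_inv_mul _ hC⟩
    rw [← spectrum.units_conjugate (a := (Cᵀ * C)⁻¹ * E) (u := u)]
    congr 1
    change _ = C * _ * C⁻¹
    rw [mul_inv_rev, hN, transpose_nonsing_inv, Matrix.mul_assoc C⁻¹,
      mul_nonsing_inv_cancel_left _ _ hC]
  have hpos : (1 + t • N).PosDef := by
    have hs : (1 + t • N).IsHermitian :=
      isHermitian_of_isSymm (isSymm_one.add (hNs.smul t))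
    rw [hs.posDef_iff_eigenvalues_pos]
    intro i
    have hi := hs.eigenvalues_mem_spectrum_real i
    set e := hs.eigenvalues i
    rw [spectrum.mem_iff] at hi
    rcases eq_or_ne t 0 with rfl | ht
    · by_contra hneg
      refine hi ?_
      have : algebraMap ℝ (Matrix ι ι ℝ) e - (1 + (0 : ℝ) • N) = algebraMap ℝ _ (e - 1) := by
        simp [map_sub]
      rw [this]
      exact (isUnit_iff_ne_zero.2 (by linarith)).map _
    · have hmem : (e - 1) / t ∈ spectrum ℝ N := by
        rw [spectrum.mem_iff]
        intro hu
        refine hi ?_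
        have : algebraMap ℝ (Matrix ι ι ℝ) e - (1 + t • N) =
            t • (algebraMap ℝ (Matrix ι ι ℝ) ((e - 1) / t) - N) := by
          rw [smul_sub, Algebra.algebraMap_eq_smul_one, Algebra.algebraMap_eq_smul_one, smul_smul,
            mul_div_cancel₀ _ ht, sub_smul, one_smul]
          abel
        rw [this]
        exact hu.smul (Units.mk0 t ht)
      have := h _ (hsp ▸ hmem)
      rwa [mul_div_cancel₀ _ ht, add_sub_cancel] at this
  have := hpos.mul_mul_transpose hCT
  rw [transpose_transpose, Matrix.mul_add, Matrix.add_mul, Matrix.mul_one, Matrix.mul_smul,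
    Matrix.smul_mul, hN, transpose_nonsing_inv, Matrix.mul_assoc (Cᵀ)⁻¹,
    mul_nonsing_inv_cancel_left _ _ hCT, nonsing_inv_mul_cancel_right _ _ hC] at this
  exact this

end Matrix

namespace SIPLOG

open Matrix

theorem stepBound_pos {m : ℕ} {σ : ℝ} (hσ : 0 < σ) (A : Mat m) : 0 < stepBound σ A := by
  unfold stepBound
  split_ifs with h
  · have := div_neg_of_pos_of_neg hσ h
    linarith
  · exact one_pos

/-- Steps up to the bound keep positive definiteness. -/
theorem posDef_add_smul_of_le_stepBound {m : ℕ} {σ t : ℝ} (hσ : σ ∈ Set.Ioo (0 : ℝ) 1) {A E : Mat m}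
    (hA : A.PosDef) (hE : E.IsSymm) (ht : 0 ≤ t) (hts : t ≤ stepBound σ (A⁻¹ * E)) :
    (A + t • E).PosDef := by
  refine hA.add_smul_of_spectrum hE fun x hx => ?_
  have hle : lambdaMin (A⁻¹ * E) ≤ x := csInf_le (Matrix.finite_spectrum _).bddBelow hx
  unfold stepBound at hts
  split_ifs at hts with h
  · have h1 : t * -lambdaMin (A⁻¹ * E) ≤ σ := by
      have := mul_le_mul_of_nonneg_right hts (neg_pos.2 h).le
      rwa [neg_mul_neg, div_mul_cancel₀ _ h.ne] at this
    nlinarith [mul_le_mul_of_nonneg_left hle ht, hσ.2]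
  · have : 0 ≤ x := (not_lt.1 h).trans hle
    positivity

/-- The trial step is bounded below in terms of the entries of the matrix. -/
theorem le_stepBound {m : ℕ} {σ C : ℝ} (hσ : 0 < σ) {A : Mat m}
    (hA : ∀ i j, |A i j| ≤ C) : min 1 (σ / (m * C + 1)) ≤ stepBound σ A := by
  unfold stepBound
  split_ifs with h
  · refine (min_le_right _ _).trans ?_
    have hne : (spectrum ℝ A).Nonempty := by
      by_contra he
      rw [Set.not_nonempty_iff_eq_empty] at he
      simp [lambdaMin, he] at h
    have hmem : lambdaMin A ∈ spectrum ℝ A := hne.csInf_mem (Matrix.finite_spectrum A)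
    have h2 := abs_le_of_mem_spectrum hA hmem
    rw [Fintype.card_fin, abs_of_neg h] at h2
    rw [← div_neg]
    exact div_le_div_of_nonneg_left hσ.le (neg_pos.2 h) (by linarith)
  · exact min_le_left _ _

end SIPLOG

/-! ### The scaled Newton direction -/

namespace SIPLOG

open Matrix

/-- The scaled Jordan equation of the matrix direction, written without the scaling: with
`M = Pᵀ P` and `W = Pᵀ U P` it is a Lyapunov equation in the original variables. -/
theorem lyapunov_of_jordan {m : ℕ} {A V P U E : Mat m} (hP : IsUnit P.det)
    (h : jordan (P * A * Pᵀ) U = jordan ((P⁻¹)ᵀ * V * P⁻¹) (P * E * Pᵀ)) :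
    Pᵀ * P * A * (Pᵀ * U * P) + Pᵀ * U * P * A * (Pᵀ * P) =
      V * E * (Pᵀ * P) + Pᵀ * P * E * V := by
  have h0 : P * A * Pᵀ * U + U * (P * A * Pᵀ) =
      (P⁻¹)ᵀ * V * P⁻¹ * (P * E * Pᵀ) + P * E * Pᵀ * ((P⁻¹)ᵀ * V * P⁻¹) :=
    smul_right_injective _ (by norm_num : (2⁻¹ : ℝ) ≠ 0) h
  have h1 : ∀ X, Pᵀ * ((P⁻¹)ᵀ * X) = X := fun X => by
    rw [← Matrix.mul_assoc, ← transpose_mul, nonsing_inv_mul _ hP, transpose_one, Matrix.one_mul]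
  have h2 : ∀ X, P⁻¹ * (P * X) = X := fun X => nonsing_inv_mul_cancel_left _ _ hP
  have h3 : P⁻¹ * P = 1 := nonsing_inv_mul _ hP
  have h4 := congrArg (fun X => Pᵀ * X * P) h0
  simp only [Matrix.mul_add, Matrix.add_mul, Matrix.mul_assoc, h1, h2, h3, Matrix.mul_one] at h4
  simpa only [Matrix.mul_assoc] using h4

theorem IsHRVW.transpose_mul_self {m : ℕ} {P A : Mat m} (h : IsHRVW P A) : Pᵀ * P = A⁻¹ := by
  obtain ⟨R, ⟨hR, rfl⟩, rfl⟩ := h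
  rw [transpose_nonsing_inv, hR.isSymm.eq, Matrix.mul_inv_rev]

theorem IsNT.transpose_mul_self {m : ℕ} {P A V : Mat m} (hA : A.PosDef) (hV : V.PosDef)
    (h : IsNT P A V) :
    Pᵀ * P * A * (Pᵀ * P) = V := by
  obtain ⟨R, Q, ⟨hR, rfl⟩, ⟨S, ⟨hS, hSS⟩, rfl⟩, ⟨Z, ⟨hZ, hZZ⟩, rfl⟩⟩ := h
  have hRu : IsUnit R.det := by
    have := hA.isUnit_det
    rw [det_mul] at this
    exact isUnit_of_mul_isUnit_left this
  have hSu : IsUnit S.det := by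
    have : IsUnit (S * S).det := by
      rw [hSS, det_mul, det_mul]
      exact (hRu.mul hV.isUnit_det).mul hRu
    rw [det_mul] at this
    exact isUnit_of_mul_isUnit_left this
  rw [transpose_nonsing_inv, hZ.isSymm.eq, ← Matrix.mul_inv_rev, hZZ, Matrix.mul_inv_rev,
    Matrix.mul_inv_rev, nonsing_inv_nonsing_inv _ hSu]
  simp only [Matrix.mul_assoc, nonsing_inv_mul_cancel_left _ _ hRu,
    mul_nonsing_inv_cancel_left _ _ hRu]
  rw [← Matrix.mul_assoc S, hSS]
  simp only [Matrix.mul_assoc, nonsing_inv_mul_cancel_left _ _ hRu]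
  rw [mul_nonsing_inv _ hRu, Matrix.mul_one]

/-- Uniqueness for the Lyapunov equation. -/
theorem lyapunov_unique {m : ℕ} {M A X : Mat m} (hM : M.PosDef) (hA : A.PosDef) (hX : X.IsSymm)
    (h : M * A * X + X * A * M = 0) : X = 0 := by
  refine hA.eq_zero_of_trace_mul_mul_mul hM.inv hX ?_
  have h1 := congrArg (fun Y => (M⁻¹ * Y * M⁻¹ * X).trace) h
  simp only [Matrix.mul_add, Matrix.add_mul, trace_add, Matrix.mul_zero, Matrix.zero_mul,
    trace_zero] at h1
  have h2 : M⁻¹ * (M * A * X) * M⁻¹ * X = A * X * M⁻¹ * X := by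
    simp only [Matrix.mul_assoc, nonsing_inv_mul_cancel_left _ _ hM.isUnit_det]
  have h3 : (M⁻¹ * (X * A * M) * M⁻¹ * X).trace = (A * X * M⁻¹ * X).trace := by
    have : M⁻¹ * (X * A * M) * M⁻¹ * X = M⁻¹ * X * (A * X) := by
      simp only [Matrix.mul_assoc, mul_nonsing_inv_cancel_left _ _ hM.isUnit_det]
    rw [this, trace_mul_comm]
    simp only [Matrix.mul_assoc]
  rw [h2, h3] at h1
  linarith

namespace Problem

variable {n m s : ℕ} {T : Type*} [TopologicalSpace T] (p : Problem n m s T)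

theorem dF_isSymm (d : Vec n) : (p.dF d).IsSymm := by
  unfold dF IsSymm
  rw [transpose_sum]
  exact Finset.sum_congr rfl fun i _ => by rw [transpose_smul, (p.Fi_symm i).eq]

variable {p}

/-- The explicit form of the matrix direction for the two scalings: writing
`D = μ F(x)⁻¹ - V - W`, the matrix `W` is the symmetrized product `V (dF) F⁻¹` for the HRVW scaling
and `M (dF) M`, with `M F M = V`, for the NT scaling. -/
theorem IsDeltaV.exists_eq {x d : Vec n} {V P D : Mat m} (hF : (p.F x).PosDef) (hV : V.PosDef)
    (hP : IsUnit P) (hs : IsHRVW P (p.F x) ∨ IsNT P (p.F x) V) (hD : p.IsDeltaV x V P d D) :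
    ∃ W : Mat m, D = p.mu • (p.F x)⁻¹ - V - W ∧
      (W = (2⁻¹ : ℝ) • (V * p.dF d * (p.F x)⁻¹ + (p.F x)⁻¹ * p.dF d * V) ∨
        ∃ M : Mat m, M.PosDef ∧ M * p.F x * M = V ∧ W = M * p.dF d * M) := by
  obtain ⟨U, hU, rfl⟩ := hD
  have hPd : IsUnit P.det := (isUnit_iff_isUnit_det _).1 hP
  refine ⟨_, rfl, ?_⟩
  have hM : (Pᵀ * P).PosDef := by
    have := PosDef.one.mul_mul_transpose (C := Pᵀ) (by rwa [det_transpose])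
    rwa [Matrix.mul_one, transpose_transpose] at this
  rcases hs with hs | hs
  · left
    have hMF := hs.transpose_mul_self
    have hi : ∀ i, Pᵀ * U i * P =
        (2⁻¹ : ℝ) • (V * p.Fi i * (p.F x)⁻¹ + (p.F x)⁻¹ * p.Fi i * V) := fun i => by
      have h := lyapunov_of_jordan hPd (hU i).2
      rw [hMF, nonsing_inv_mul _ hF.isUnit_det, Matrix.one_mul,
        mul_nonsing_inv_cancel_right _ _ hF.isUnit_det, ← two_smul ℝ] at h
      rw [← h, smul_smul]
      norm_num
    simp only [hi, dF, Finset.mul_sum, Finset.sum_mul, ← Finset.sum_add_distrib, Finset.smul_sum,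
      Matrix.mul_smul, Matrix.smul_mul, smul_add, smul_comm _ (2⁻¹ : ℝ)]
  · right
    have hMF := hs.transpose_mul_self hF hV
    refine ⟨Pᵀ * P, hM, hMF, ?_⟩
    have hi : ∀ i, Pᵀ * U i * P = Pᵀ * P * p.Fi i * (Pᵀ * P) := fun i => by
      have h := lyapunov_of_jordan hPd (hU i).2
      generalize Pᵀ * P = M at *
      refine sub_eq_zero.1 (lyapunov_unique hM hF ?_ ?_)
      · simp only [IsSymm, transpose_sub, transpose_mul, (hU i).1.eq, transpose_transpose,
          hM.isSymm.eq, (p.Fi_symm i).eq, Matrix.mul_assoc]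
      · rw [Matrix.mul_sub, Matrix.sub_mul, Matrix.sub_mul, sub_add_sub_comm, h, ← hMF]
        simp only [Matrix.mul_assoc, sub_self]
    simp only [hi, dF, Finset.mul_sum, Finset.sum_mul, Matrix.mul_smul, Matrix.smul_mul]

theorem IsDeltaV.isSymm {x d : Vec n} {V P D : Mat m} (hF : (p.F x).PosDef) (hV : V.PosDef)
    (hD : p.IsDeltaV x V P d D) : D.IsSymm := by
  obtain ⟨U, hU, rfl⟩ := hD
  refine ((hF.inv.isSymm.smul _).sub hV.isSymm).sub ?_
  unfold IsSymm
  rw [transpose_sum]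
  exact Finset.sum_congr rfl fun i _ => by
    simp only [transpose_smul, transpose_mul, (hU i).1.eq, transpose_transpose, Matrix.mul_assoc]

/-- For both scalings the directional derivative of `ψ` does not depend on the direction. -/
theorem psiDeriv_eq {x d : Vec n} {V P D : Mat m} (hF : (p.F x).PosDef) (hV : V.PosDef)
    (hP : IsUnit P) (hs : IsHRVW P (p.F x) ∨ IsNT P (p.F x) V) (hD : p.IsDeltaV x V P d D) :
    p.psiDeriv x V d D =
      -(p.F x * (V - p.mu • (p.F x)⁻¹) * V⁻¹ * (V - p.mu • (p.F x)⁻¹)).trace := by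
  obtain ⟨W, rfl, hW⟩ := hD.exists_eq hF hV hP hs
  have hFu := hF.isUnit_det
  have hVu := hV.isUnit_det
  have h1 : (p.F x * W).trace = (p.dF d * V).trace ∧
      (V⁻¹ * W).trace = ((p.F x)⁻¹ * p.dF d).trace := by
    rcases hW with rfl | ⟨M, hM, hMF, rfl⟩
    · have e1 : (p.F x * (V * p.dF d * (p.F x)⁻¹)).trace = (p.dF d * V).trace := by
        rw [trace_mul_comm, Matrix.mul_assoc, nonsing_inv_mul _ hFu, Matrix.mul_one,
          trace_mul_comm]
      have e2 : p.F x * ((p.F x)⁻¹ * p.dF d * V) = p.dF d * V := by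
        rw [Matrix.mul_assoc, mul_nonsing_inv_cancel_left _ _ hFu]
      have e3 : (V⁻¹ * (V * p.dF d * (p.F x)⁻¹)).trace = ((p.F x)⁻¹ * p.dF d).trace := by
        rw [Matrix.mul_assoc, nonsing_inv_mul_cancel_left _ _ hVu, trace_mul_comm]
      have e4 : (V⁻¹ * ((p.F x)⁻¹ * p.dF d * V)).trace = ((p.F x)⁻¹ * p.dF d).trace := by
        rw [trace_mul_comm, mul_nonsing_inv_cancel_right _ _ hVu]
      simp only [Matrix.mul_smul, Matrix.mul_add, trace_smul, trace_add, e1, e2, e3, e4,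
        smul_eq_mul]
      constructor <;> ring
    · have e1 : (p.F x * (M * p.dF d * M)).trace = (p.dF d * V).trace := by
        rw [← hMF, ← Matrix.mul_assoc, trace_mul_comm, trace_mul_comm (p.dF d)]
        simp only [Matrix.mul_assoc]
      have e2 : (V⁻¹ * (M * p.dF d * M)).trace = ((p.F x)⁻¹ * p.dF d).trace := by
        rw [← Matrix.mul_assoc, trace_mul_comm, ← hMF, Matrix.mul_inv_rev, Matrix.mul_inv_rev]
        simp only [Matrix.mul_assoc, nonsing_inv_mul_cancel_left _ _ hM.isUnit_det,
          mul_nonsing_inv_cancel_left _ _ hM.isUnit_det]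
      exact ⟨e1, e2⟩
  simp only [psiDeriv, trace_sub, trace_add, Matrix.mul_sub, Matrix.sub_mul, Matrix.mul_smul,
    Matrix.smul_mul, trace_smul, smul_eq_mul, h1.1, h1.2, mul_nonsing_inv _ hFu,
    nonsing_inv_mul _ hVu, mul_nonsing_inv_cancel_right _ _ hVu, Matrix.one_mul]
  ring

theorem psiDeriv_nonpos {x d : Vec n} {V P D : Mat m} (hF : (p.F x).PosDef) (hV : V.PosDef)
    (hP : IsUnit P) (hs : IsHRVW P (p.F x) ∨ IsNT P (p.F x) V) (hD : p.IsDeltaV x V P d D) :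
    p.psiDeriv x V d D ≤ 0 := by
  rw [psiDeriv_eq hF hV hP hs hD, neg_nonpos]
  exact hF.posSemidef.trace_mul_mul_mul_nonneg hV.inv.posSemidef
    (hV.isSymm.sub (hF.inv.isSymm.smul _))

end Problem

end SIPLOG

/-! ### Limits along ultrafilters -/

theorem Ultrafilter.exists_tendsto_of_norm_le {α E : Type*} [NormedAddCommGroup E] [ProperSpace E]
    {U : Ultrafilter α} {u : α → E} {C : ℝ} (h : ∀ᶠ a in (U : Filter α), ‖u a‖ ≤ C) :
    ∃ e, Tendsto u U (𝓝 e) := by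
  obtain ⟨e, -, he⟩ := (isCompact_closedBall (0 : E) C).ultrafilter_le_nhds (U.map u)
    (le_principal_iff.2 (h.mono fun a ha => mem_closedBall_zero_iff.2 ha))
  exact ⟨e, he⟩

theorem Ultrafilter.exists_tendsto_matrix {α ι κ : Type*} {U : Ultrafilter α}
    {X : α → Matrix ι κ ℝ} {C : ℝ} (h : ∀ᶠ a in (U : Filter α), ∀ i j, |X a i j| ≤ C) :
    ∃ A, Tendsto X U (𝓝 A) := by
  have h1 : ∀ i j, ∃ e, Tendsto (fun a => X a i j) U (𝓝 e) := fun i j =>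
    U.exists_tendsto_of_norm_le (C := C) (h.mono fun a ha => ha i j)
  choose A hA using h1
  exact ⟨Matrix.of A, tendsto_pi_nhds.2 fun i => tendsto_pi_nhds.2 fun j => hA i j⟩

/-! ### Signed measures -/

namespace SIPLOG

section Measures

variable {T : Type*} [MeasurableSpace T]

theorem exists_measure_of_nonneg {y : SignedMeasure T} (hy : 0 ≤ y) :
    ∃ (μ : Measure T) (_ : IsFiniteMeasure μ), μ.toSignedMeasure = y :=
  ⟨_, _, y.toMeasureOfZeroLE_toSignedMeasure ((VectorMeasure.le_restrict_univ_iff_le _ _).2 hy)⟩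

theorem tvNorm_toSignedMeasure (μ : Measure T) [IsFiniteMeasure μ] :
    tvNorm μ.toSignedMeasure = μ.real Set.univ := by
  have h1 : IsGreatest {t : ℝ | ∃ A : Set T, MeasurableSet A ∧ μ.toSignedMeasure A = t}
      (μ.real Set.univ) :=
    ⟨⟨_, MeasurableSet.univ, by simp⟩, by
      rintro _ ⟨A, hA, rfl⟩
      rw [Measure.toSignedMeasure_apply_measurable hA]
      exact measureReal_mono (Set.subset_univ A)⟩
  have h2 : IsLeast {t : ℝ | ∃ A : Set T, MeasurableSet A ∧ μ.toSignedMeasure A = t} 0 :=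
    ⟨⟨∅, MeasurableSet.empty, by simp⟩, by
      rintro _ ⟨A, hA, rfl⟩
      rw [Measure.toSignedMeasure_apply_measurable hA]
      exact measureReal_nonneg⟩
  rw [tvNorm, h1.csSup_eq, h2.csInf_eq, sub_zero]

variable [TopologicalSpace T] [CompactSpace T] [BorelSpace T]

theorem integrable_continuousMap {E : Type*} [NormedAddCommGroup E] [SecondCountableTopology E]
    (μ : Measure T) [IsFiniteMeasure μ] (φ : C(T, E)) :
    Integrable (fun τ => φ τ) μ := by
  borelize E
  exact Integrable.of_bound φ.continuous.measurable.aestronglyMeasurable ‖φ‖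
    (ae_of_all _ φ.norm_coe_le_norm)

theorem inner_vectorIntegral {E : Type*} [NormedAddCommGroup E] [InnerProductSpace ℝ E]
    [CompleteSpace E] [SecondCountableTopology E] {y : SignedMeasure T} (hy : 0 ≤ y) (φ : C(T, E))
    (v : E) : inner ℝ (∫ᵛ τ, φ τ ∂<•y) v = ∫ᵛ τ, inner ℝ (φ τ) v ∂<•y := by
  obtain ⟨μ, _, rfl⟩ := exists_measure_of_nonneg hy
  rw [VectorMeasure.integral_toSignedMeasure, VectorMeasure.integral_toSignedMeasure,
    real_inner_comm, ← integral_inner (integrable_continuousMap μ φ)]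
  simp only [real_inner_comm]

/-- Pairing of uniformly convergent integrands with weak* convergent nonnegative measures: the total
masses are bounded because they converge to the mass of the limit. -/
theorem tendsto_integral_of_weakStar {α : Type*} {l : Filter α} {y : α → SignedMeasure T}
    {y' : SignedMeasure T} (hy : ∀ᶠ a in l, 0 ≤ y a)
    (hlim : Tendsto (fun a => weakStar (y a)) l (𝓝 (weakStar y')))
    {φ : α → C(T, ℝ)} {φ' : C(T, ℝ)} (hφ : Tendsto φ l (𝓝 φ')) :
    Tendsto (fun a => weakStar (y a) (φ a)) l (𝓝 (weakStar y' φ')) := by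
  rw [tendsto_pi_nhds] at hlim
  have h1 := hlim φ'
  have h2 : Tendsto (fun a => ‖φ a - φ'‖ * weakStar (y a) 1) l (𝓝 0) := by
    have := (tendsto_iff_norm_sub_tendsto_zero.1 hφ).mul (hlim 1)
    rwa [zero_mul] at this
  have h3 : Tendsto (fun a => weakStar (y a) (φ a) - weakStar (y a) φ') l (𝓝 0) := by
    refine squeeze_zero_norm' (hy.mono fun a ha => ?_) h2
    obtain ⟨μ, _, hμ⟩ := exists_measure_of_nonneg ha
    rw [← hμ]
    simp only [weakStar, VectorMeasure.integral_toSignedMeasure]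
    rw [← integral_sub (integrable_continuousMap μ _) (integrable_continuousMap μ _)]
    refine (norm_integral_le_of_norm_le_const
      (ae_of_all _ (φ a - φ').norm_coe_le_norm)).trans (le_of_eq ?_)
    simp
  simpa using h3.add h1

end Measures

/-- A signed measure on a compact metric space which is nonnegative on nonnegative continuous
functions is nonnegative: by the Jordan decomposition, thickened indicators compare the two parts
on closed sets, and regularity passes to all measurable sets. -/
theorem nonneg_of_weakStar_nonneg {T : Type*} [MetricSpace T] [CompactSpace T] [MeasurableSpace T]
    [BorelSpace T] {y : SignedMeasure T} (h : ∀ φ : C(T, ℝ), 0 ≤ φ → 0 ≤ weakStar y φ) : 0 ≤ y := by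
  set μ := y.toJordanDecomposition.posPart with hμ
  set ν := y.toJordanDecomposition.negPart with hν
  have hy : y = μ.toSignedMeasure - ν.toSignedMeasure :=
    y.toSignedMeasure_toJordanDecomposition.symm
  have hint : ∀ φ : C(T, ℝ), 0 ≤ φ → ∫ τ, φ τ ∂ν ≤ ∫ τ, φ τ ∂μ := fun φ hφ => by
    have h1 := h φ hφ
    rw [hy, weakStar, VectorMeasure.integral_sub_vectorMeasure] at h1
    · simpa using h1
    · simpa [VectorMeasure.Integrable] using integrable_continuousMap μ φ
    · simpa [VectorMeasure.Integrable] using integrable_continuousMap ν φ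
  have hclosed : ∀ K : Set T, IsClosed K → ν.real K ≤ μ.real K := fun K hK => by
    have hpos : ∀ k : ℕ, (0 : ℝ) < 1 / (k + 1) := fun k => by positivity
    refine le_of_tendsto_of_tendsto'
      (tendsto_integral_thickenedIndicator_of_isClosed ν hK hpos
        tendsto_one_div_add_atTop_nhds_zero_nat)
      (tendsto_integral_thickenedIndicator_of_isClosed μ hK hpos
        tendsto_one_div_add_atTop_nhds_zero_nat)
      fun k => ?_
    exact hint ⟨fun τ => (thickenedIndicator (hpos k) K τ : ℝ), by fun_prop⟩ fun τ => by simp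
  have hmeas : ∀ A : Set T, MeasurableSet A → ν.real A ≤ μ.real A := fun A hA => by
    refine le_of_forall_pos_le_add fun ε hε => ?_
    obtain ⟨K, hKA, hK, hlt⟩ := hA.exists_isClosed_lt_add (measure_ne_top ν A)
      (ENNReal.ofReal_pos.2 hε).ne'
    have h1 : ν.real A ≤ ν.real K + ε := by
      have := ENNReal.toReal_mono (by finiteness) hlt.le
      rwa [ENNReal.toReal_add (by finiteness) (by finiteness), ENNReal.toReal_ofReal hε.le] at this
    linarith [hclosed K hK, measureReal_mono (μ := μ) hKA]
  intro A hA
  rw [hy, Measure.toSignedMeasure_sub_apply hA]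
  simpa using hmeas A hA

end SIPLOG

/-! ### Gradients of a family of convex functions -/

section Gradient

variable {E : Type*} [NormedAddCommGroup E] [InnerProductSpace ℝ E] [CompleteSpace E]

theorem hasDerivAt_comp_add_smul {f : E → ℝ} {x : E} (hd : DifferentiableAt ℝ f x)
    (u : E) : HasDerivAt (fun t : ℝ => f (x + t • u)) (inner ℝ (gradient f x) u) 0 := by
  have h1 : HasFDerivAt f (fderiv ℝ f x) (x + (0 : ℝ) • u) := by
    simpa using hd.hasFDerivAt
  have h2 : HasDerivAt (fun t : ℝ => x + t • u) u 0 := by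
    simpa using ((hasDerivAt_id (0 : ℝ)).smul_const u).const_add x
  have h3 : inner ℝ (gradient f x) u = fderiv ℝ f x u := by simp
  rw [h3]
  exact h1.comp_hasDerivAt (0 : ℝ) h2

theorem ConvexOn.inner_gradient_le_sub {f : E → ℝ} (hf : ConvexOn ℝ Set.univ f)
    {x : E} (hd : DifferentiableAt ℝ f x) (u : E) :
    inner ℝ (gradient f x) u ≤ f (x + u) - f x := by
  have hc : ConvexOn ℝ Set.univ fun t : ℝ => f (x + t • u) := by
    have := hf.comp_affineMap (AffineMap.lineMap x (x + u))
    simpa [AffineMap.lineMap_apply, Function.comp_def, add_comm] using this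
  have hder := hasDerivAt_comp_add_smul hd u
  have := hc.le_slope_of_hasDerivAt (Set.mem_univ 0) (Set.mem_univ 1) one_pos hder
  simpa [slope_def_field] using this

/-- The gradients of a family of differentiable convex functions which depends continuously on a
parameter are jointly continuous, weakly: the gradient inequality bounds them by difference
quotients. -/
theorem continuous_inner_gradient_of_convexOn {T : Type*} [TopologicalSpace T] {g : E → T → ℝ}
    (hg : Continuous fun q : E × T => g q.1 q.2)
    (hconv : ∀ τ, ConvexOn ℝ Set.univ fun x => g x τ)
    (hdiff : ∀ τ, Differentiable ℝ fun x => g x τ) (u : E) :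
    Continuous fun q : E × T => inner ℝ (gradient (fun x => g x q.2) q.1) u := by
  have key : ∀ (v : E) (q₀ : E × T) (a : ℝ), inner ℝ (gradient (fun x => g x q₀.2) q₀.1) v < a →
      ∀ᶠ q in 𝓝 q₀, inner ℝ (gradient (fun x => g x q.2) q.1) v < a := fun v q₀ a ha => by
    have hder := hasDerivAt_comp_add_smul (hdiff q₀.2 q₀.1) v
    obtain ⟨t, ht, htpos⟩ :=
      ((hder.tendsto_slope_zero_right.eventually_lt_const ha).and self_mem_nhdsWithin).exists
    have ht0 : (0 : ℝ) < t := htpos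
    have hcont : Continuous fun q : E × T => t⁻¹ • (g (q.1 + t • v) q.2 - g q.1 q.2) := by
      have : Continuous fun q : E × T => g (q.1 + t • v) q.2 :=
        hg.comp ((continuous_fst.add continuous_const).prodMk continuous_snd)
      fun_prop
    have hev := (hcont.tendsto q₀).eventually_lt_const (u := a) (by simpa using ht)
    filter_upwards [hev] with q hq
    refine lt_of_le_of_lt ?_ hq
    have := (hconv q.2).inner_gradient_le_sub (hdiff q.2 q.1) (t • v)
    rw [real_inner_smul_right] at this
    rw [smul_eq_mul, ← div_eq_inv_mul, le_div_iff₀ ht0]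
    linarith
  rw [continuous_iff_continuousAt]
  intro q₀
  refine tendsto_order.2 ⟨fun a ha => ?_, fun a ha => key u q₀ a ha⟩
  filter_upwards [key (-u) q₀ (-a) (by rw [inner_neg_right]; linarith)] with q hq
  rw [inner_neg_right] at hq
  linarith

end Gradient

namespace SIPLOG.Problem

variable {n m s : ℕ} {T : Type*} [TopologicalSpace T] (p : Problem n m s T)

theorem continuous_gradG : Continuous fun q : Vec n × T => p.gradG q.1 q.2 := by
  refine (PiLp.continuous_toLp 2 _).comp (continuous_pi fun i => ?_ : Continuous
    fun q : Vec n × T => (p.gradG q.1 q.2).ofLp)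
  have := continuous_inner_gradient_of_convexOn p.g_continuous p.g_convex
    (fun τ => (p.g_contDiff τ).differentiable one_ne_zero) (EuclideanSpace.single i (1 : ℝ))
  simpa [gradG, EuclideanSpace.inner_single_right, -inner_gradient_left] using this

/-- The constraint functions `x ↦ g(x, ·)` as a map to `C(T)`. -/
def gMap (x : Vec n) : C(T, ℝ) := ⟨p.g x, p.g_continuous.comp (Continuous.prodMk_right x)⟩

/-- The constraint gradients `x ↦ ∇ₓ g(x, ·)` as a map to `C(T, ℝⁿ)`. -/
noncomputable def gradGMap (x : Vec n) : C(T, Vec n) :=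
  ⟨p.gradG x, p.continuous_gradG.comp (Continuous.prodMk_right x)⟩

theorem continuous_gMap : Continuous p.gMap :=
  (ContinuousMap.curry ⟨_, p.g_continuous⟩).continuous

theorem continuous_gradGMap : Continuous p.gradGMap :=
  (ContinuousMap.curry ⟨_, p.continuous_gradG⟩).continuous

end SIPLOG.Problem

/-! ### The merit function along the search direction -/

namespace SIPLOG.Problem

open Matrix

variable {n m s : ℕ} {T : Type*} [TopologicalSpace T] (p : Problem n m s T)

theorem F_add_smul (x d : Vec n) (t : ℝ) : p.F (x + t • d) = p.F x + t • p.dF d := by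
  simp only [F, dF, PiLp.add_apply, PiLp.smul_apply, add_smul, smul_eq_mul, mul_smul,
    Finset.sum_add_distrib, Finset.smul_sum]
  abel

theorem continuous_dF : Continuous p.dF := by
  unfold dF
  fun_prop

theorem continuous_gradient_f : Continuous (gradient p.f) :=
  (InnerProductSpace.toDual ℝ (Vec n)).symm.continuous.comp
    (p.f_contDiff.continuous_fderiv one_ne_zero)

theorem continuous_F : Continuous p.F := continuous_const.add p.continuous_dF

theorem continuous_adjF : Continuous p.adjF := by
  unfold adjF inn
  fun_prop

theorem continuous_mulG : Continuous p.mulG := by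
  unfold mulG
  fun_prop

theorem continuous_mulGT : Continuous p.mulGT := by
  unfold mulGT
  fun_prop

theorem inner_adjF (X : Mat m) (d : Vec n) : inner ℝ (p.adjF X) d = (X * p.dF d).trace := by
  simp [adjF, inn, dF, PiLp.inner_apply, Finset.mul_sum, trace_sum, trace_mul_comm X]

theorem mulG_add_smul_of_mulG_add {x d : Vec n} (hx : p.mulG x = p.h) (hd : p.mulG (x + d) = p.h)
    (t : ℝ) : p.mulG (x + t • d) = p.h := by
  have h0 : p.mulG d = 0 := by
    simp only [mulG, WithLp.ofLp_add, mulVec_add] at hx hd ⊢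
    rwa [hx, add_eq_left] at hd
  simp only [mulG, WithLp.ofLp_add, WithLp.ofLp_smul, mulVec_add, mulVec_smul] at hx h0 ⊢
  rw [h0, hx, smul_zero, add_zero]

theorem inner_mulGT_eq_zero {x d : Vec n} (hx : p.mulG x = p.h) (hd : p.mulG (x + d) = p.h)
    (z : Fin s → ℝ) : inner ℝ (p.mulGT z) d = 0 := by
  have h0 : p.G *ᵥ d.ofLp = 0 := by
    simp only [mulG, WithLp.ofLp_add, mulVec_add] at hx hd ⊢
    rwa [hx, add_eq_left] at hd
  have : inner ℝ (p.mulGT z) d = (p.G *ᵥ d.ofLp) ⬝ᵥ z := by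
    rw [dotProduct_comm, dotProduct_mulVec, ← mulVec_transpose, dotProduct_comm]
    simp [mulGT, PiLp.inner_apply, dotProduct]
  rw [this, h0, zero_dotProduct]

theorem inner_toLp_mulVec (B : Mat n) (d : Vec n) :
    inner ℝ (WithLp.toLp 2 (B *ᵥ d.ofLp) : Vec n) d = d.ofLp ⬝ᵥ (B *ᵥ d.ofLp) := by
  simp [PiLp.inner_apply, dotProduct]

theorem theta_nonneg (x : Vec n) : 0 ≤ p.theta x :=
  Real.iSup_nonneg fun _ => le_max_right _ _

theorem theta_le {x : Vec n} {C : ℝ} (hC : 0 ≤ C) (h : ∀ τ, p.g x τ ≤ C) : p.theta x ≤ C :=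
  Real.iSup_le (fun τ => max_le (h τ) hC) hC

theorem le_theta [CompactSpace T] (x : Vec n) (τ : T) : p.g x τ ≤ p.theta x := by
  have hb : BddAbove (Set.range fun τ => max (p.g x τ) 0) := by
    refine (isCompact_range ?_).bddAbove
    exact ((p.gMap x).continuous).max continuous_const
  exact (le_max_left _ _).trans (le_ciSup hb τ)

/-- The slope of the smooth part of the merit function along a direction of the quadratic program:
the stationarity condition, tested with the direction. -/
theorem IsDirection.inner_gradient_le [CompactSpace T] [MeasurableSpace T] [BorelSpace T]
    {p : Problem n m s T} {x d : Vec n} {B : Mat n} {γ : ℝ} {y : SignedMeasure T} {z : Fin s → ℝ}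
    (h : p.IsDirection x B γ d y z) (hx : p.mulG x = p.h) :
    inner ℝ (gradient p.f x) d - p.mu * ((p.F x)⁻¹ * p.dF d).trace ≤
      -(d.ofLp ⬝ᵥ (B *ᵥ d.ofLp)) + tvNorm y * p.theta x := by
  obtain ⟨μ, _, hμ⟩ := exists_measure_of_nonneg h.y_supp.1
  have h1 := congrArg (fun v => inner ℝ v d) h.stationarity
  have h2 := h.complementarity
  simp only [inner_add_left, inner_sub_left, inner_zero_left, real_inner_smul_left, xi, inner_adjF,
    inner_toLp_mulVec, p.inner_mulGT_eq_zero hx h.equality] at h1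
  have h3 : inner ℝ (∫ᵛ τ, p.gradG x τ ∂<•y) d = ∫ᵛ τ, inner ℝ (p.gradG x τ) d ∂<•y :=
    inner_vectorIntegral h.y_supp.1 (p.gradGMap x) d
  rw [h3] at h1
  rw [← hμ, VectorMeasure.integral_toSignedMeasure] at h1 h2
  rw [← hμ, tvNorm_toSignedMeasure]
  have hint : Integrable (fun τ => p.gradG x τ) μ := integrable_continuousMap μ (p.gradGMap x)
  have hintg : Integrable (fun τ => p.g x τ) μ := integrable_continuousMap μ (p.gMap x)
  have h4 : ∫ τ, p.g x τ ∂μ + ∫ τ, inner ℝ (p.gradG x τ) d ∂μ = 0 := by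
    rw [← integral_add hintg (hint.inner_const d)]
    exact h2
  have h5 : ∫ τ, p.g x τ ∂μ ≤ μ.real Set.univ * p.theta x := by
    calc _ ≤ ∫ _τ, p.theta x ∂μ := integral_mono hintg (integrable_const _) (p.le_theta x)
      _ = _ := by simp
  linarith

/-- The remainder, per unit of step length, in the first-order estimate `merit_add_smul_le` of the
merit function. Its terms come from `f`, from the penalty term (a sup norm over `T`), from the two
`log det` terms and from the bilinear term of `ψ`. -/
noncomputable def remainder [CompactSpace T] (ν ρ : ℝ) (x : Vec n) (V : Mat m) (d : Vec n)
    (D : Mat m) (t : ℝ) : ℝ :=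
  ((p.f (x + t • d) - p.f x) / t - inner ℝ (gradient p.f x) d) +
    ρ * (‖p.gradGMap (x + t • d) - p.gradGMap x‖ * ‖d‖) +
    p.mu * (1 + ν) * (((p.F x)⁻¹ * p.dF d).trace - ((p.F (x + t • d))⁻¹ * p.dF d).trace) +
    p.mu * ν * ((V⁻¹ * D).trace - ((V + t • D)⁻¹ * D).trace) +
    ν * t * (p.dF d * D).trace

/-- The penalty term decreases: `θ(x + t d) ≤ (1 - t) θ(x) + t γ` up to the remainder. Convexity
bounds `g(x + t d, τ)` by the gradient at the new point. -/
theorem theta_add_smul_le [CompactSpace T] {x d : Vec n} {γ t : ℝ} (hγ : 0 ≤ γ)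
    (hl : ∀ τ, max (p.linG x d τ) 0 ≤ γ) (ht : 0 ≤ t) (ht1 : t ≤ 1) :
    p.theta (x + t • d) ≤ (1 - t) * p.theta x + t * γ +
      t * (‖p.gradGMap (x + t • d) - p.gradGMap x‖ * ‖d‖) := by
  have hθ := p.theta_nonneg x
  have h1t : 0 ≤ 1 - t := by linarith
  refine p.theta_le (by positivity) fun τ => ?_
  have h1 := (p.g_convex τ).inner_gradient_le_sub
    ((p.g_contDiff τ).differentiable one_ne_zero (x + t • d)) (-(t • d))
  rw [add_neg_cancel_right, inner_neg_right, real_inner_smul_right] at h1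
  have h2 : inner ℝ (p.gradG (x + t • d) τ - p.gradG x τ) d ≤
      ‖p.gradGMap (x + t • d) - p.gradGMap x‖ * ‖d‖ :=
    (real_inner_le_norm _ _).trans (mul_le_mul_of_nonneg_right
      ((p.gradGMap (x + t • d) - p.gradGMap x).norm_coe_le_norm τ) (norm_nonneg d))
  have h3 := (le_max_left _ _).trans (hl τ)
  rw [inner_sub_left] at h2
  unfold linG at h3
  change -(t * inner ℝ (p.gradG (x + t • d) τ) d) ≤ _ at h1
  have h4 := mul_le_mul_of_nonneg_left (p.le_theta x τ) h1t
  have h5 := mul_le_mul_of_nonneg_left h2 ht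
  have h6 := mul_le_mul_of_nonneg_left h3 ht
  linarith

theorem merit_add_smul_le [CompactSpace T] [MeasurableSpace T] [BorelSpace T]
    {x d : Vec n} {V D : Mat m} {B : Mat n} {ν ρ γ t : ℝ} {y : SignedMeasure T} {z : Fin s → ℝ}
    (hν : 0 ≤ ν) (hγ : 0 ≤ γ) (hd : p.IsDirection x B γ d y z) (hx : p.mulG x = p.h)
    (hρ0 : 0 ≤ ρ) (hρ : tvNorm y ≤ ρ) (ht : 0 < t) (ht1 : t ≤ 1)
    (hF : (p.F x).PosDef) (hF' : (p.F (x + t • d)).PosDef) (hV : V.PosDef)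
    (hV' : (V + t • D).PosDef) :
    p.merit ν ρ (x + t • d) (V + t • D) ≤ p.merit ν ρ x V +
      t * (-(d.ofLp ⬝ᵥ (B *ᵥ d.ofLp) - ν * p.psiDeriv x V d D) + ρ * γ +
        p.remainder ν ρ x V d D t) := by
  have h1 := hd.inner_gradient_le hx
  have h2 := p.theta_add_smul_le hγ hd.relaxed ht.le ht1
  have h3 : t * ((p.F (x + t • d))⁻¹ * p.dF d).trace ≤
      Real.log (p.F (x + t • d)).det - Real.log (p.F x).det := by
    rw [p.F_add_smul] at hF' ⊢
    exact hF.le_log_det_add_sub hF'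
  have h4 := hV.le_log_det_add_sub hV'
  have h5 : (p.F (x + t • d) * (V + t • D)).trace = (p.F x * V).trace +
      t * ((p.dF d * V).trace + (p.F x * D).trace) + t * t * (p.dF d * D).trace := by
    simp only [p.F_add_smul, Matrix.add_mul, Matrix.mul_add, Matrix.smul_mul, Matrix.mul_smul,
      trace_add, trace_smul, smul_eq_mul]
    ring
  have hθ := p.theta_nonneg x
  have h6 : tvNorm y * p.theta x ≤ ρ * p.theta x := mul_le_mul_of_nonneg_right hρ hθ
  simp only [merit, chi, psi, inn, hx, p.mulG_add_smul_of_mulG_add hx hd.equality, sub_self,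
    abs_zero, Finset.sum_const_zero, mul_zero, add_zero, hF'.log_det_mul hV', hF.log_det_mul hV, h5]
  simp only [psiDeriv, remainder, trace_add, trace_sub, trace_smul, smul_eq_mul]
  set a := ‖p.gradGMap (x + t • d) - p.gradGMap x‖ * ‖d‖
  have hmu := p.mu_pos.le
  have k2 := mul_le_mul_of_nonneg_left h2 hρ0
  have k3 := mul_le_mul_of_nonneg_left h3 (by positivity : 0 ≤ p.mu * (1 + ν))
  have k4 := mul_le_mul_of_nonneg_left h4 (by positivity : 0 ≤ p.mu * ν)
  have k1 := mul_le_mul_of_nonneg_left (h1.trans (add_le_add_right h6 _)) ht.le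
  have kf : p.f (x + t • d) = p.f x + t * ((p.f (x + t • d) - p.f x) / t) := by
    rw [mul_div_cancel₀ _ ht.ne']; ring
  generalize (p.f (x + t • d) - p.f x) / t = q at *
  rw [kf]
  nlinarith [k1, k2, k3, k4]

/-- The remainder vanishes for step lengths tending to zero, when the point and the direction may
vary with the step length but converge, and the matrices have positive definite limits. -/
theorem tendsto_remainder [CompactSpace T] {α : Type*} {l : Filter α} {x d : α → Vec n}
    {V D : α → Mat m} {t : α → ℝ} {x' d' : Vec n} {V' D' : Mat m} (ν ρ : ℝ)
    (hx : Tendsto x l (𝓝 x')) (hd : Tendsto d l (𝓝 d')) (hV : Tendsto V l (𝓝 V'))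
    (hD : Tendsto D l (𝓝 D')) (ht : Tendsto t l (𝓝 0)) (ht0 : ∀ᶠ a in l, t a ≠ 0)
    (hF' : (p.F x').PosDef) (hV' : V'.PosDef) :
    Tendsto (fun a => p.remainder ν ρ (x a) (V a) (d a) (D a) (t a)) l (𝓝 0) := by
  have hxt : Tendsto (fun a => x a + t a • d a) l (𝓝 x') := by
    simpa using hx.add (ht.smul hd)
  have hVt : Tendsto (fun a => V a + t a • D a) l (𝓝 V') := by
    simpa using hV.add (ht.smul hD)
  have hdF : Tendsto (fun a => p.dF (d a)) l (𝓝 (p.dF d')) := (p.continuous_dF.tendsto d').comp hd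
  have htr : ∀ {X : α → Mat m} {X' : Mat m}, Tendsto X l (𝓝 X') →
      Tendsto (fun a => (X a).trace) l (𝓝 X'.trace) := fun {X X'} h =>
    ((Continuous.matrix_trace continuous_id).tendsto X').comp h
  have hFi : Tendsto (fun a => (p.F (x a))⁻¹) l (𝓝 (p.F x')⁻¹) :=
    tendsto_inv ((p.continuous_F.tendsto x').comp hx) hF'.isUnit_det
  have hFti : Tendsto (fun a => (p.F (x a + t a • d a))⁻¹) l (𝓝 (p.F x')⁻¹) :=
    tendsto_inv ((p.continuous_F.tendsto x').comp hxt) hF'.isUnit_det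
  have e1 : Tendsto (fun a => (p.f (x a + t a • d a) - p.f (x a)) / t a -
      inner ℝ (gradient p.f (x a)) (d a)) l (𝓝 0) := by
    have h1 := (p.f_contDiff.contDiffAt (x := x')).hasStrictFDerivAt one_ne_zero
    have h2 := h1.isLittleO.comp_tendsto (hxt.prodMk_nhds hx)
    have h3 : (fun a => t a • d a) =O[l] t := by
      simpa using (Asymptotics.isBigO_refl t l).smul (hd.isBigO_one ℝ)
    have h4 : (fun a => p.f (x a + t a • d a) - p.f (x a) - fderiv ℝ p.f x' (t a • d a))
        =o[l] t := by
      simpa [Function.comp_def] using h2.trans_isBigO (by simpa [Function.comp_def] using h3)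
    have h5 := h4.tendsto_div_nhds_zero
    have h6 : Tendsto (fun a => fderiv ℝ p.f x' (d a) - inner ℝ (gradient p.f (x a)) (d a)) l
        (𝓝 0) := by
      have k1 := ((fderiv ℝ p.f x').continuous.tendsto d').comp hd
      have k2 := ((p.continuous_gradient_f.tendsto x').comp hx).inner hd (𝕜 := ℝ)
      simpa using k1.sub k2
    refine ((h5.add h6).congr' ?_).trans (by simp)
    filter_upwards [ht0] with a ha
    rw [map_smul, smul_eq_mul]
    field_simp
    ring
  have e2 : Tendsto (fun a => ρ * (‖p.gradGMap (x a + t a • d a) - p.gradGMap (x a)‖ * ‖d a‖))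
      l (𝓝 0) := by
    have := (((((p.continuous_gradGMap.tendsto x').comp hxt).sub
      ((p.continuous_gradGMap.tendsto x').comp hx)).norm).mul hd.norm).const_mul ρ
    simpa using this
  have e3 := ((htr (hFi.mul hdF)).sub (htr (hFti.mul hdF))).const_mul (p.mu * (1 + ν))
  have e4 := ((htr ((tendsto_inv hV hV'.isUnit_det).mul hD)).sub
    (htr ((tendsto_inv hVt hV'.isUnit_det).mul hD))).const_mul (p.mu * ν)
  have e5 := (ht.const_mul ν).mul (htr (hdF.mul hD))
  simpa [remainder] using (((e1.add e2).add e3).add e4).add e5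

end SIPLOG.Problem

/-! ### Invariants of a run -/

namespace SIPLOG

open Matrix

/-- Lower bound for `tr (A B) - μ log det (A B)`, from `log λ ≤ κ λ - 1 - log κ` at
`κ = 1 / (2 μ)`: half of the trace is kept. -/
theorem exists_le_trace_sub_log_det (m : ℕ) {μ : ℝ} (hμ : 0 < μ) :
    ∃ K : ℝ, ∀ A B : Mat m, A.PosDef → B.PosDef →
      (A * B).trace / 2 - K ≤ (A * B).trace - μ * Real.log (A * B).det := by
  refine ⟨-(μ * (m + m * Real.log (2 * μ)⁻¹)), fun A B hA hB => ?_⟩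
  have hk : (0 : ℝ) < (2 * μ)⁻¹ := by positivity
  have h1 := (hA.smul hk).log_det_mul_le hB
  rw [Matrix.smul_mul, det_smul, trace_smul, smul_eq_mul, Fintype.card_fin,
    Real.log_mul (by positivity) (by rw [det_mul]; exact (mul_pos hA.det_pos hB.det_pos).ne'),
    Real.log_pow] at h1
  have h2 := mul_le_mul_of_nonneg_left h1 hμ.le
  have h3 : μ * ((2 * μ)⁻¹ * (A * B).trace) = (A * B).trace / 2 := by field_simp
  linarith

theorem Problem.initialStep_pos {n m s : ℕ} {T : Type*} [TopologicalSpace T] (p : Problem n m s T)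
    {σ : ℝ} (hσ : 0 < σ) (x : Vec n) (V : Mat m) (d : Vec n) (D : Mat m) :
    0 < p.initialStep σ x V d D :=
  lt_min (lt_min (stepBound_pos hσ _) (stepBound_pos hσ _)) one_pos

theorem Problem.posDef_of_le_initialStep {n m s : ℕ} {T : Type*} [TopologicalSpace T]
    (p : Problem n m s T) {σ t : ℝ} (hσ : σ ∈ Set.Ioo (0 : ℝ) 1) {x d : Vec n} {V D : Mat m}
    (hF : (p.F x).PosDef) (hV : V.PosDef) (hD : D.IsSymm) (ht : 0 ≤ t)
    (hts : t ≤ p.initialStep σ x V d D) :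
    (p.F (x + t • d)).PosDef ∧ (V + t • D).PosDef := by
  rw [p.F_add_smul]
  have h1 := hts.trans (min_le_left _ _)
  exact ⟨posDef_add_smul_of_le_stepBound hσ hF (p.dF_isSymm d) ht (h1.trans (min_le_left _ _)),
    posDef_add_smul_of_le_stepBound hσ hV hD ht (h1.trans (min_le_right _ _))⟩

namespace Run

variable {n m s : ℕ} {T : Type*} [TopologicalSpace T] [MeasurableSpace T]
  {p : Problem n m s T} {c : Params} (R : Run p c)

theorem step_pos (r : ℕ) : 0 < R.step r := by
  rw [R.step_eq]
  exact mul_pos (p.initialStep_pos c.σ_mem.1 _ _ _ _) (pow_pos c.β₁_mem.1 _)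

theorem step_le (r : ℕ) :
    R.step r ≤ p.initialStep c.σ (R.x r) (R.V r) (R.dx r) (R.dV r) := by
  rw [R.step_eq]
  exact mul_le_of_le_one_right (p.initialStep_pos c.σ_mem.1 _ _ _ _).le
    (pow_le_one₀ c.β₁_mem.1.le c.β₁_mem.2.le)

theorem step_le_one (r : ℕ) : R.step r ≤ 1 := (R.step_le r).trans (min_le_right _ _)

theorem posDef (r : ℕ) : (p.F (R.x r)).PosDef ∧ (R.V r).PosDef := by
  induction r with
  | zero => exact ⟨R.F_x_zero, R.V_zero⟩
  | succ r ih =>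
    rw [R.x_succ, R.V_succ]
    exact p.posDef_of_le_initialStep c.σ_mem ih.1 ih.2 ((R.deltaV r).isSymm ih.1 ih.2)
      (R.step_pos r).le (R.step_le r)

theorem γ_eq (r : ℕ) : R.γ r = c.β₂ ^ r * c.γ₀ := by
  induction r with
  | zero => simp [R.γ_zero]
  | succ r ih => rw [R.γ_succ, ih]; ring

theorem γ_pos (r : ℕ) : 0 < R.γ r := by
  rw [R.γ_eq]
  exact mul_pos (pow_pos c.β₂_mem.1 r) c.γ₀_pos

theorem tendsto_γ : Tendsto R.γ atTop (𝓝 0) := by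
  have : R.γ = fun r => c.β₂ ^ r * c.γ₀ := funext R.γ_eq
  rw [this]
  simpa using (tendsto_pow_atTop_nhds_zero_of_lt_one c.β₂_mem.1.le c.β₂_mem.2).mul_const c.γ₀

theorem max_le_ρ_succ (r : ℕ) : max (tvNorm (R.y (r + 1))) ‖R.z (r + 1)‖ ≤ R.ρ (r + 1) := by
  rw [R.ρ_succ]
  split_ifs with h
  · exact h.le
  · linarith [c.δ_pos]

theorem ρ_succ_eq_or (r : ℕ) : R.ρ (r + 1) = R.ρ r ∨ R.ρ r + c.δ ≤ R.ρ (r + 1) := by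
  rw [R.ρ_succ]
  split_ifs with h
  · exact Or.inl rfl
  · exact Or.inr (by linarith [not_lt.1 h])

theorem monotone_ρ : Monotone R.ρ := monotone_nat_of_le_succ fun r => by
  rcases R.ρ_succ_eq_or r with h | h
  · exact h.ge
  · linarith [c.δ_pos]

theorem ρ_pos (r : ℕ) : 0 < R.ρ r :=
  c.ρ₀_pos.trans_le (R.ρ_zero ▸ R.monotone_ρ (Nat.zero_le r))

/-- Every change of the penalty parameter increases it by at least `δ`, so that a bounded sequence
of parameters is eventually constant. -/
theorem eventually_ρ_eq (h : ∃ M : ℝ, ∀ r, |R.ρ r| ≤ M) :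
    ∃ ρ : ℝ, 0 < ρ ∧ ∀ᶠ r in atTop, R.ρ (r + 1) = ρ := by
  obtain ⟨M, hM⟩ := h
  have hbdd : BddAbove (Set.range R.ρ) := ⟨M, by
    rintro _ ⟨r, rfl⟩
    exact (le_abs_self _).trans (hM r)⟩
  have hlim := tendsto_atTop_ciSup R.monotone_ρ hbdd
  have hdiff : Tendsto (fun r => R.ρ (r + 1) - R.ρ r) atTop (𝓝 0) := by
    simpa using (hlim.comp (tendsto_add_atTop_nat 1)).sub hlim
  obtain ⟨N, hN⟩ := eventually_atTop.1 (hdiff.eventually_lt_const c.δ_pos)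
  have hstep : ∀ r ≥ N, R.ρ (r + 1) = R.ρ r := fun r hr => by
    rcases R.ρ_succ_eq_or r with h | h
    · exact h
    · linarith [hN r hr]
  have hconst : ∀ k, R.ρ (N + k) = R.ρ N := fun k => by
    induction k with
    | zero => rfl
    | succ k ih => rw [← add_assoc, hstep _ (Nat.le_add_right N k), ih]
  refine ⟨R.ρ N, R.ρ_pos N, eventually_atTop.2 ⟨N, fun r hr => ?_⟩⟩
  obtain ⟨k, rfl⟩ := Nat.exists_eq_add_of_le hr
  exact hconst (k + 1)

theorem mulG_eq (h0 : p.mulG (R.x 0) = p.h) (r : ℕ) : p.mulG (R.x r) = p.h := by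
  induction r with
  | zero => exact h0
  | succ r ih =>
    rw [R.x_succ]
    exact p.mulG_add_smul_of_mulG_add ih (R.direction r).equality _

theorem exists_measure_succ (r : ℕ) :
    ∃ (μ : Measure T) (_ : IsFiniteMeasure μ), μ.toSignedMeasure = R.y (r + 1) ∧
      μ.real Set.univ = tvNorm (R.y (r + 1)) := by
  obtain ⟨μ, _, hμ⟩ := exists_measure_of_nonneg (R.direction r).y_supp.1
  exact ⟨μ, _, hμ, by rw [← hμ, tvNorm_toSignedMeasure]⟩

/-- The predicted decrease `ΔΦ_r` of the merit function. -/
noncomputable def decrease (r : ℕ) : ℝ :=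
  (R.dx r).ofLp ⬝ᵥ (R.B r *ᵥ (R.dx r).ofLp) -
    c.ν * p.psiDeriv (R.x r) (R.V r) (R.dx r) (R.dV r)

section

variable {R}

theorem AssumptionA.psiDeriv_nonpos (hA : R.AssumptionA) (r : ℕ) :
    p.psiDeriv (R.x r) (R.V r) (R.dx r) (R.dV r) ≤ 0 :=
  Problem.psiDeriv_nonpos (R.posDef r).1 (R.posDef r).2 (R.P_isUnit r) (hA.scaling r) (R.deltaV r)

theorem dotProduct_mulVec_nonneg (r : ℕ) :
    0 ≤ (R.dx r).ofLp ⬝ᵥ (R.B r *ᵥ (R.dx r).ofLp) := by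
  simpa using (R.B_posDef r).posSemidef.dotProduct_mulVec_nonneg (R.dx r).ofLp

theorem AssumptionA.decrease_nonneg (hA : R.AssumptionA) (r : ℕ) : 0 ≤ R.decrease r := by
  unfold decrease
  nlinarith [hA.psiDeriv_nonpos r, dotProduct_mulVec_nonneg (R := R) r, c.ν_pos]

/-- Continuous functions are bounded along the iterates. -/
theorem AssumptionA.exists_abs_le (hA : R.AssumptionA) {φ : Vec n → ℝ} (hφ : Continuous φ) :
    ∃ C, ∀ r, |φ (R.x r)| ≤ C := by
  obtain ⟨M, hM⟩ := hA.x_bdd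
  obtain ⟨C, hC⟩ := (isCompact_closedBall (0 : Vec n) M).exists_bound_of_continuousOn
    hφ.continuousOn
  exact ⟨C, fun r => hC _ (mem_closedBall_zero_iff.2 (hM r))⟩

theorem AssumptionA.exists_log_det_le (hA : R.AssumptionA) :
    ∃ C, ∀ r, Real.log (p.F (R.x r)).det ≤ C := by
  obtain ⟨C, hC⟩ := hA.exists_abs_le (φ := fun x => (p.F x).trace)
    ((Continuous.matrix_trace continuous_id).comp p.continuous_F)
  exact ⟨C - m, fun r => (R.posDef r).1.log_det_le.trans
    (by simpa using (abs_le.1 (hC r)).2)⟩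

/-- Consequences of the line search for a penalty parameter that is eventually constant: the merit
values, corrected by the sum `ρ γ_r / (1 - β₂)` of the remaining relaxation terms, decrease. Being
bounded below they converge, so the accepted decreases tend to zero, and the merit values are
bounded above. -/
theorem AssumptionA.tendsto_step_mul_decrease (hA : R.AssumptionA) :
    Tendsto (fun r => R.step r * R.decrease r) atTop (𝓝 0) ∧
      ∃ C, ∀ᶠ r in atTop, -(p.mu * Real.log (p.F (R.x r)).det) ≤ C ∧
        c.ν * p.psi (R.x r) (R.V r) ≤ C := by
  obtain ⟨ρ, hρ0, hρ⟩ := R.eventually_ρ_eq hA.penalty_bdd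
  obtain ⟨N, hN⟩ := eventually_atTop.1 hρ
  have hβ : 0 < 1 - c.β₂ := sub_pos.2 c.β₂_mem.2
  set Ψ : ℕ → ℝ := fun r =>
    p.merit c.ν ρ (R.x r) (R.V r) + ρ * (R.γ r / (1 - c.β₂)) with hΨ
  have hdesc : ∀ r ≥ N, Ψ (r + 1) ≤ Ψ r - c.α * (R.step r * R.decrease r) := fun r hr => by
    have h1 := (R.ℓ_least r).1
    rw [Set.mem_ofPred_eq, ← R.step_eq, Problem.Armijo, hN r hr, ← R.x_succ, ← R.V_succ] at h1
    change _ ≤ _ - c.α * R.step r * R.decrease r + _ at h1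
    have h2 : R.γ r / (1 - c.β₂) = R.γ r + R.γ (r + 1) / (1 - c.β₂) := by
      rw [R.γ_succ]; field_simp; ring
    have h3 : ρ * R.step r * R.γ r ≤ ρ * R.γ r :=
      mul_le_mul_of_nonneg_right (mul_le_of_le_one_right hρ0.le (R.step_le_one r)) (R.γ_pos r).le
    simp only [hΨ]
    rw [h2, mul_add]
    linarith
  obtain ⟨Cf, hCf⟩ := hA.exists_abs_le p.f_contDiff.continuous
  obtain ⟨Cd, hCd⟩ := hA.exists_log_det_le
  obtain ⟨K, hK⟩ := exists_le_trace_sub_log_det m p.mu_pos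
  have hpsi : ∀ r, -K ≤ p.psi (R.x r) (R.V r) := fun r => by
    have h1 := hK _ _ (R.posDef r).1 (R.posDef r).2
    have h2 : 0 ≤ (p.F (R.x r) * R.V r).trace := by
      have := (R.posDef r).1.posSemidef.trace_mul_mul_mul_nonneg (R.posDef r).2.posSemidef
        (X := 1) isSymm_one
      simpa using this
    unfold Problem.psi inn
    linarith
  -- the merit function dominates each of its terms up to constants
  have hge : ∀ r, -Cf - p.mu * Real.log (p.F (R.x r)).det + c.ν * p.psi (R.x r) (R.V r) ≤ Ψ r :=
    fun r => by
      have h1 := (abs_le.1 (hCf r)).1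
      have h2 : 0 ≤ ρ * p.theta (R.x r) := mul_nonneg hρ0.le (p.theta_nonneg _)
      have h3 : 0 ≤ ρ * ∑ j, |p.mulG (R.x r) j - p.h j| :=
        mul_nonneg hρ0.le (Finset.sum_nonneg fun _ _ => abs_nonneg _)
      have h4 : 0 ≤ ρ * (R.γ r / (1 - c.β₂)) :=
        mul_nonneg hρ0.le (div_nonneg (R.γ_pos r).le hβ.le)
      simp only [hΨ, Problem.merit, Problem.chi]
      linarith
  have hmul1 : ∀ r, p.mu * Real.log (p.F (R.x r)).det ≤ p.mu * Cd := fun r =>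
    mul_le_mul_of_nonneg_left (hCd r) p.mu_pos.le
  have hmul2 : ∀ r, c.ν * -K ≤ c.ν * p.psi (R.x r) (R.V r) := fun r =>
    mul_le_mul_of_nonneg_left (hpsi r) c.ν_pos.le
  have hanti : Antitone fun k => Ψ (k + N) := antitone_nat_of_succ_le fun k => by
    have h1 := hdesc (k + N) (Nat.le_add_left N k)
    have h2 : 0 ≤ c.α * (R.step (k + N) * R.decrease (k + N)) :=
      mul_nonneg c.α_mem.1.le (mul_nonneg (R.step_pos _).le (hA.decrease_nonneg _))
    rw [add_right_comm]
    linarith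
  constructor
  · have hbdd : BddBelow (Set.range fun k => Ψ (k + N)) := ⟨-Cf - p.mu * Cd + c.ν * -K, by
      rintro _ ⟨k, rfl⟩
      linarith [hge (k + N), hmul1 (k + N), hmul2 (k + N)]⟩
    have hlim := tendsto_atTop_ciInf hanti hbdd
    rw [← tendsto_add_atTop_iff_nat N]
    have hdiff : Tendsto (fun k => (Ψ (k + N) - Ψ (k + 1 + N)) / c.α) atTop (𝓝 0) := by
      simpa using (hlim.sub (hlim.comp (tendsto_add_atTop_nat 1))).div_const c.α
    refine squeeze_zero (fun k => mul_nonneg (R.step_pos _).le (hA.decrease_nonneg _))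
      (fun k => ?_) hdiff
    rw [le_div_iff₀ c.α_mem.1, add_right_comm]
    linarith [hdesc (k + N) (Nat.le_add_left N k)]
  · refine ⟨max (Ψ N + Cf - c.ν * -K) (Ψ N + Cf + p.mu * Cd), eventually_atTop.2
      ⟨N, fun r hr => ?_⟩⟩
    have h1 : Ψ r ≤ Ψ N := by
      obtain ⟨k, rfl⟩ := Nat.exists_eq_add_of_le hr
      simpa [add_comm] using hanti (Nat.zero_le k)
    exact ⟨le_max_of_le_left (by linarith [hge r, hmul2 r]),
      le_max_of_le_right (by linarith [hge r, hmul1 r])⟩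

/-- The iterates stay in a compact set of pairs of positive definite matrices. -/
theorem AssumptionA.exists_det_trace_bounds (hA : R.AssumptionA) :
    ∃ ε > 0, ∃ C, ∀ᶠ r in atTop, ε ≤ (p.F (R.x r)).det ∧ ε ≤ (R.V r).det ∧ (R.V r).trace ≤ C := by
  obtain ⟨-, C, hC⟩ := hA.tendsto_step_mul_decrease
  obtain ⟨Cd, hCd⟩ := hA.exists_log_det_le
  obtain ⟨K, hK⟩ := exists_le_trace_sub_log_det m p.mu_pos
  obtain ⟨Ca, hCa⟩ := hA.exists_abs_le (φ := fun x => (p.F x).adjugate.trace)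
    (Continuous.matrix_trace (Continuous.matrix_adjugate p.continuous_F))
  have hmu := p.mu_pos
  set a := -(C / p.mu) with ha
  set b := -(C / c.ν / p.mu) - Cd with hb
  refine ⟨min (Real.exp a) (Real.exp b), lt_min (Real.exp_pos _) (Real.exp_pos _),
    (m : ℝ) ^ 2 * (((Real.exp a)⁻¹ * Ca) * (2 * (C / c.ν + K))), hC.mono fun r hr => ?_⟩
  obtain ⟨hF, hV⟩ := R.posDef r
  have hdetF : Real.exp a ≤ (p.F (R.x r)).det := by
    rw [← Real.le_log_iff_exp_le hF.det_pos, ha, neg_le, ← mul_le_mul_iff_right₀ hmu,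
      mul_div_cancel₀ _ hmu.ne']
    linarith [hr.1]
  have hpsi : p.psi (R.x r) (R.V r) ≤ C / c.ν := by
    rw [le_div_iff₀ c.ν_pos, mul_comm]
    exact hr.2
  have htr : (p.F (R.x r) * R.V r).trace ≤ 2 * (C / c.ν + K) := by
    have := hK _ _ hF hV
    unfold Problem.psi inn at hpsi
    linarith
  have htr0 : 0 ≤ (p.F (R.x r) * R.V r).trace := by
    simpa using hF.posSemidef.trace_mul_mul_mul_nonneg hV.posSemidef (X := 1) isSymm_one
  have hdetV : Real.exp b ≤ (R.V r).det := by
    rw [← Real.le_log_iff_exp_le hV.det_pos, hb]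
    unfold Problem.psi inn at hpsi
    rw [hF.log_det_mul hV] at hpsi
    have h1 : -(C / c.ν / p.mu) ≤ Real.log (p.F (R.x r)).det + Real.log (R.V r).det := by
      rw [neg_le, ← mul_le_mul_iff_right₀ hmu, mul_div_cancel₀ _ hmu.ne']
      linarith
    linarith [hCd r]
  refine ⟨(min_le_left _ _).trans hdetF, (min_le_right _ _).trans hdetV,
    (hF.trace_le_trace_inv_mul_trace hV.posSemidef).trans ?_⟩
  rw [Fintype.card_fin]
  have hinv : (p.F (R.x r))⁻¹.trace ≤ (Real.exp a)⁻¹ * Ca := by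
    rw [inv_def, Ring.inverse_eq_inv', trace_smul, smul_eq_mul]
    have h1 : ((p.F (R.x r)).det)⁻¹ ≤ (Real.exp a)⁻¹ := inv_anti₀ (Real.exp_pos _) hdetF
    have h2 : 0 ≤ ((p.F (R.x r)).det)⁻¹ := (inv_pos.2 hF.det_pos).le
    calc _ ≤ ((p.F (R.x r)).det)⁻¹ * Ca :=
          mul_le_mul_of_nonneg_left ((le_abs_self _).trans (hCa r)) h2
      _ ≤ _ := mul_le_mul_of_nonneg_right h1 ((abs_nonneg _).trans (hCa r))
  have h0 : 0 ≤ (p.F (R.x r))⁻¹.trace := hF.inv.posSemidef.trace_nonneg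
  exact mul_le_mul_of_nonneg_left (mul_le_mul hinv htr htr0 (h0.trans hinv)) (by positivity)

end

end Run

end SIPLOG

/-! ### Limits of the iterates and of the directions -/

namespace SIPLOG

open Matrix

theorem eventually_abs_le_of_tendsto {α ι κ : Type*} [Finite ι] [Finite κ] {l : Filter α}
    {X : α → Matrix ι κ ℝ} {A : Matrix ι κ ℝ} (h : Tendsto X l (𝓝 A)) :
    ∃ C, 0 ≤ C ∧ ∀ᶠ a in l, ∀ i j, |X a i j| ≤ C := by
  cases nonempty_fintype ι
  cases nonempty_fintype κ
  refine ⟨∑ i, ∑ j, (|A i j| + 1), by positivity, ?_⟩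
  rw [eventually_all]
  intro i
  rw [eventually_all]
  intro j
  have h1 : Tendsto (fun a => |X a i j|) l (𝓝 |A i j|) :=
    ((tendsto_pi_nhds.1 (tendsto_pi_nhds.1 h i)) j).abs
  refine (h1.eventually_le_const (lt_add_one _)).mono fun a ha => ha.trans ?_
  refine (Finset.single_le_sum (f := fun j => |A i j| + 1) (fun k _ => by positivity)
    (Finset.mem_univ j)).trans ?_
  exact Finset.single_le_sum (f := fun i => ∑ j, (|A i j| + 1)) (fun k _ => by positivity)
    (Finset.mem_univ i)

/-- A symmetric solution `M` of `M A M = V` is bounded in terms of `A⁻¹` and `V`. -/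
theorem abs_le_of_mul_mul_eq {m : ℕ} {A V M : Mat m} (hA : A.PosDef) (hM : M.IsSymm)
    (h : M * A * M = V) (i j : Fin m) :
    |M i j| ≤ (m : ℝ) ^ 2 * (A⁻¹.trace * V.trace) + 1 := by
  have hMM : (M * M).PosSemidef := by
    have := posSemidef_conjTranspose_mul_self M
    rwa [conjTranspose_eq_transpose_of_trivial, hM.eq] at this
  have h1 := hA.trace_le_trace_inv_mul_trace hMM
  have h2 : (A * (M * M)).trace = V.trace := by
    rw [← h, ← Matrix.mul_assoc, trace_mul_comm, ← Matrix.mul_assoc]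
  rw [h2, Fintype.card_fin] at h1
  have h3 : M i j ^ 2 ≤ (M * M) i i := by
    rw [mul_apply]
    refine le_trans (le_of_eq ?_) (Finset.single_le_sum (f := fun k => M i k * M k i)
      (fun k _ => ?_) (Finset.mem_univ j))
    · simp only [sq, hM.apply i j]
    · simp only [hM.apply i k]
      exact mul_self_nonneg _
  have h4 := (le_abs_self _).trans (hMM.abs_apply_le_trace i i)
  nlinarith [sq_abs (M i j), sq_nonneg (|M i j| - 1)]

theorem tendsto_trace {α : Type*} {l : Filter α} {m : ℕ} {X : α → Mat m} {A : Mat m}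
    (h : Tendsto X l (𝓝 A)) : Tendsto (fun a => (X a).trace) l (𝓝 A.trace) :=
  ((Continuous.matrix_trace continuous_id).tendsto A).comp h

namespace Run

section

variable {n m s : ℕ} {T : Type*} [TopologicalSpace T] [MeasurableSpace T]
  {p : Problem n m s T} {c : Params} {R : Run p c}

theorem AssumptionA.exists_limit (hA : R.AssumptionA) {U : Ultrafilter ℕ}
    (hU : (U : Filter ℕ) ≤ atTop) :
    ∃ x V, Tendsto R.x U (𝓝 x) ∧ Tendsto R.V U (𝓝 V) ∧ (p.F x).PosDef ∧ V.PosDef := by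
  obtain ⟨M, hM⟩ := hA.x_bdd
  obtain ⟨x, hx⟩ := U.exists_tendsto_of_norm_le (Eventually.of_forall hM)
  obtain ⟨ε, hε, C, hC⟩ := hA.exists_det_trace_bounds
  have hC' := hU hC
  obtain ⟨V, hV⟩ := U.exists_tendsto_matrix (X := R.V) (C := C) (Filter.Eventually.mono hC'
    fun r hr i j => ((R.posDef r).2.posSemidef.abs_apply_le_trace i j).trans hr.2.2)
  refine ⟨x, V, hx, hV, ?_, ?_⟩
  · exact posDef_of_tendsto ((p.continuous_F.tendsto x).comp hx)
      (Eventually.of_forall fun r => (R.posDef r).1) hε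
      (Filter.Eventually.mono hC' fun r hr => hr.1)
  · exact posDef_of_tendsto hV (Eventually.of_forall fun r => (R.posDef r).2) hε
      (Filter.Eventually.mono hC' fun r hr => hr.2.1)

theorem mul_norm_sq_le {η : ℝ} {r : ℕ} (h : (R.B r - η • (1 : Mat n)).PosSemidef) :
    η * ‖R.dx r‖ ^ 2 ≤ (R.dx r).ofLp ⬝ᵥ (R.B r *ᵥ (R.dx r).ofLp) := by
  have h1 := h.dotProduct_mulVec_nonneg (R.dx r).ofLp
  rw [star_trivial, sub_mulVec, dotProduct_sub, smul_mulVec, one_mulVec, dotProduct_smul,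
    smul_eq_mul] at h1
  have h2 : ‖R.dx r‖ ^ 2 = (R.dx r).ofLp ⬝ᵥ (R.dx r).ofLp := by
    rw [EuclideanSpace.real_norm_sq_eq]
    simp [dotProduct, sq]
  rw [h2]
  linarith

/-- The matrix directions converge along an ultrafilter with the other data. -/
theorem AssumptionA.exists_limit_dV (hA : R.AssumptionA) {U : Ultrafilter ℕ} {x d : Vec n}
    {V : Mat m} (hx : Tendsto R.x U (𝓝 x)) (hV : Tendsto R.V U (𝓝 V)) (hd : Tendsto R.dx U (𝓝 d))
    (hF : (p.F x).PosDef) : ∃ D, Tendsto R.dV U (𝓝 D) := by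
  have hex := fun r => (R.deltaV r).exists_eq (R.posDef r).1 (R.posDef r).2 (R.P_isUnit r)
    (hA.scaling r)
  choose W hDW hW using hex
  have hFx : Tendsto (fun r => p.F (R.x r)) U (𝓝 (p.F x)) := (p.continuous_F.tendsto x).comp hx
  have hFi := tendsto_inv hFx hF.isUnit_det
  have hdF : Tendsto (fun r => p.dF (R.dx r)) U (𝓝 (p.dF d)) := (p.continuous_dF.tendsto d).comp hd
  obtain ⟨W', hW'⟩ : ∃ W', Tendsto W U (𝓝 W') := by
    rcases Ultrafilter.eventually_or.1 (Eventually.of_forall hW) with h | h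
    · exact ⟨_, ((((hV.mul hdF).mul hFi).add ((hFi.mul hdF).mul hV)).const_smul (2⁻¹ : ℝ)).congr'
        (Filter.Eventually.mono h fun r hr => hr.symm)⟩
    · have hM : ∀ r, ∃ M : Mat m, (∃ M : Mat m, M.PosDef ∧ M * p.F (R.x r) * M = R.V r ∧
          W r = M * p.dF (R.dx r) * M) → (M.PosDef ∧ M * p.F (R.x r) * M = R.V r ∧
          W r = M * p.dF (R.dx r) * M) := fun r => by
        by_cases hr : ∃ M : Mat m, M.PosDef ∧ M * p.F (R.x r) * M = R.V r ∧
          W r = M * p.dF (R.dx r) * M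
        · exact ⟨hr.choose, fun _ => hr.choose_spec⟩
        · exact ⟨0, fun h => absurd h hr⟩
      choose M hM using hM
      have hbd := (((tendsto_trace hFi).mul (tendsto_trace hV)).const_mul ((m : ℝ) ^ 2)).add_const 1
      obtain ⟨M', hM'⟩ := U.exists_tendsto_matrix (X := M) (by
        filter_upwards [h, hbd.eventually_le_const (lt_add_one _)] with r hr hb i j
        obtain ⟨h1, h2, -⟩ := hM r hr
        exact (abs_le_of_mul_mul_eq (R.posDef r).1 h1.isSymm h2 i j).trans hb)
      exact ⟨_, ((hM'.mul hdF).mul hM').congr'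
        (Filter.Eventually.mono h fun r hr => (hM r hr).2.2.symm)⟩
  refine ⟨p.mu • (p.F x)⁻¹ - V - W', ?_⟩
  have : R.dV = fun r => p.mu • (p.F (R.x r))⁻¹ - R.V r - W r := funext hDW
  rw [this]
  exact ((hFi.const_smul p.mu).sub hV).sub hW'

end

variable {n m s : ℕ} {T : Type*} [TopologicalSpace T] [CompactSpace T] [MeasurableSpace T]
  {p : Problem n m s T} {c : Params} {R : Run p c}

/-- The directions are bounded, by coercivity of `B_r` and boundedness of the multipliers. -/
theorem AssumptionA.exists_limit_dx (hA : R.AssumptionA) (hB : R.AssumptionB) {U : Ultrafilter ℕ}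
    {x : Vec n} (hx : Tendsto R.x U (𝓝 x)) (hF : (p.F x).PosDef) :
    ∃ d, Tendsto R.dx U (𝓝 d) := by
  obtain ⟨η₁, η₂, hη, -, hBB⟩ := hB
  obtain ⟨M, hM⟩ := hA.penalty_bdd
  have hρM : ∀ r, R.ρ r ≤ M := fun r => (le_abs_self _).trans (hM r)
  have hFi := tendsto_inv ((p.continuous_F.tendsto x).comp hx) hF.isUnit_det
  have h1 := ((p.continuous_gradient_f.tendsto x).comp hx).norm
  have h2 := (((p.continuous_adjF.tendsto _).comp hFi).norm).const_mul p.mu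
  have h3 := (((p.continuous_gradGMap.tendsto x).comp hx).norm).mul_const M
  obtain ⟨C, hC⟩ := (isCompact_closedBall (0 : Fin s → ℝ) M).exists_bound_of_continuousOn
    p.continuous_mulGT.continuousOn
  have hlim := (((h1.add h2).add h3).add_const C).div_const η₁
  refine U.exists_tendsto_of_norm_le ((hlim.eventually_le_const (lt_add_one _)).mono
    fun r hr => le_trans ?_ hr)
  obtain ⟨μ, _, hμ, hμu⟩ := R.exists_measure_succ r
  have hmax := R.max_le_ρ_succ r
  have hst := congrArg (fun v => inner ℝ v (R.dx r)) (R.direction r).stationarity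
  have hz : ‖p.mulGT (R.z (r + 1))‖ ≤ C :=
    hC _ (mem_closedBall_zero_iff.2 (((le_max_right _ _).trans hmax).trans (hρM _)))
  have hint : ‖∫ᵛ τ, p.gradG (R.x r) τ ∂<•R.y (r + 1)‖ ≤ ‖p.gradGMap (R.x r)‖ * M := by
    rw [← hμ, VectorMeasure.integral_toSignedMeasure]
    refine (norm_integral_le_of_norm_le_const
      (ae_of_all _ (p.gradGMap (R.x r)).norm_coe_le_norm)).trans ?_
    rw [hμu]
    exact mul_le_mul_of_nonneg_left (((le_max_left _ _).trans hmax).trans (hρM _)) (norm_nonneg _)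
  simp only [inner_add_left, inner_sub_left, inner_zero_left, real_inner_smul_left,
    Problem.inner_toLp_mulVec] at hst
  have hq := mul_norm_sq_le (hBB r).2
  have k : ∀ v : Vec n, -(inner ℝ v (R.dx r)) ≤ ‖v‖ * ‖R.dx r‖ := fun v =>
    (neg_le_abs _).trans (abs_real_inner_le_norm _ _)
  have k1 := k (gradient p.f (R.x r))
  have k2 := mul_le_mul_of_nonneg_left (real_inner_le_norm (p.xi (R.x r)) (R.dx r)) p.mu_pos.le
  have k3 := k (∫ᵛ τ, p.gradG (R.x r) τ ∂<•R.y (r + 1))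
  have k4 := k (p.mulGT (R.z (r + 1)))
  have hd0 := norm_nonneg (R.dx r)
  rcases hd0.eq_or_lt with h0 | hpos
  · rw [← h0]
    have := (norm_nonneg _).trans hz
    have hM0 : 0 ≤ M := (R.ρ_pos 0).le.trans (hρM 0)
    have := p.mu_pos
    simp only [Function.comp_def]
    positivity
  · rw [le_div_iff₀ hη, mul_comm]
    refine le_of_mul_le_mul_right ?_ hpos
    have k3' := mul_le_mul_of_nonneg_right hint hd0
    have k4' := mul_le_mul_of_nonneg_right hz hd0
    simp only [Function.comp_def]
    have e : p.xi (R.x r) = p.adjF (p.F (R.x r))⁻¹ := rfl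
    rw [e] at k2 hst
    nlinarith [k1, k2, k3, k4, k3', k4', hq, hst]

variable [BorelSpace T]

/-- The predicted decreases tend to zero. Otherwise, along some ultrafilter, they are bounded below
while the step lengths tend to zero; the last rejected trial steps then tend to zero too, and the
first-order estimate of the merit function contradicts their rejection. -/
theorem AssumptionA.tendsto_decrease (hA : R.AssumptionA) (hB : R.AssumptionB) :
    Tendsto R.decrease atTop (𝓝 0) := by
  rw [tendsto_iff_ultrafilter]
  intro U hU
  refine tendsto_order.2 ⟨fun a ha =>
    Eventually.of_forall fun r => ha.trans_le (hA.decrease_nonneg r), fun ε hε => ?_⟩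
  by_contra hcon
  have hge : ∀ᶠ r in (U : Filter ℕ), ε ≤ R.decrease r := by
    simpa only [not_lt] using Ultrafilter.eventually_not.2 hcon
  obtain ⟨x, V, hx, hV, hF, hVp⟩ := hA.exists_limit hU
  obtain ⟨d, hd⟩ := hA.exists_limit_dx hB hx hF
  obtain ⟨D, hD⟩ := hA.exists_limit_dV hx hV hd hF
  have hstep : Tendsto R.step U (𝓝 0) := by
    have h1 : Tendsto (fun r => R.step r * R.decrease r / ε) U (𝓝 0) := by
      simpa using (hA.tendsto_step_mul_decrease.1.mono_left hU).div_const ε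
    refine tendsto_of_tendsto_of_tendsto_of_le_of_le' tendsto_const_nhds h1
      (Eventually.of_forall fun r => (R.step_pos r).le) (hge.mono fun r hr => ?_)
    rw [le_div_iff₀ hε]
    exact mul_le_mul_of_nonneg_left hr (R.step_pos r).le
  -- the initial trial steps are bounded away from zero
  have hdF : Tendsto (fun r => p.dF (R.dx r)) U (𝓝 (p.dF d)) := (p.continuous_dF.tendsto d).comp hd
  have hFi := tendsto_inv ((p.continuous_F.tendsto x).comp hx) hF.isUnit_det
  obtain ⟨C₁, hC₁0, hC₁⟩ := eventually_abs_le_of_tendsto (hFi.mul hdF)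
  obtain ⟨C₂, hC₂0, hC₂⟩ := eventually_abs_le_of_tendsto ((tendsto_inv hV hVp.isUnit_det).mul hD)
  have hσ := c.σ_mem.1
  set κ := min (min (min 1 (c.σ / (m * C₁ + 1))) (min 1 (c.σ / (m * C₂ + 1)))) 1
  have hκ : 0 < κ := by
    refine lt_min (lt_min (lt_min one_pos ?_) (lt_min one_pos ?_)) one_pos <;> positivity
  have hinit : ∀ᶠ r in (U : Filter ℕ),
      κ ≤ p.initialStep c.σ (R.x r) (R.V r) (R.dx r) (R.dV r) := by
    filter_upwards [hC₁, hC₂] with r h1 h2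
    exact min_le_min (min_le_min (le_stepBound hσ h1) (le_stepBound hσ h2)) le_rfl
  obtain ⟨ρ, hρ0, hρ⟩ := R.eventually_ρ_eq hA.penalty_bdd
  have hβ := c.β₁_mem.1
  have ht : Tendsto (fun r => R.step r / c.β₁) U (𝓝 0) := by
    simpa using hstep.div_const c.β₁
  have hrem := p.tendsto_remainder c.ν ρ hx hd hV hD ht
    (Eventually.of_forall fun r => (div_pos (R.step_pos r) hβ).ne') hF hVp
  have hα : 0 < 1 - c.α := sub_pos.2 c.α_mem.2
  have hfin : ∀ᶠ r in (U : Filter ℕ), False := by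
    filter_upwards [hge, hinit, hU hρ, hstep.eventually_lt_const hκ,
      hrem.eventually_lt_const (mul_pos hα hε)] with r hr hir hρr hsr hremr
    have hℓ : R.ℓ r ≠ 0 := fun h0 => by
      have := R.step_eq r
      rw [h0, pow_zero, mul_one] at this
      linarith
    obtain ⟨k, hk⟩ := Nat.exists_eq_succ_of_ne_zero hℓ
    have htk : R.step r / c.β₁ =
        p.initialStep c.σ (R.x r) (R.V r) (R.dx r) (R.dV r) * c.β₁ ^ k := by
      rw [R.step_eq, hk, pow_succ, ← mul_assoc, mul_div_cancel_right₀ _ hβ.ne']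
    have hnot : ¬ p.Armijo c.α c.ν (R.ρ (r + 1)) (R.γ r) (R.x r) (R.V r) (R.B r) (R.dx r) (R.dV r)
        (R.step r / c.β₁) := fun h => by
      rw [htk] at h
      have := (R.ℓ_least r).2 h
      omega
    have ht0 : 0 < R.step r / c.β₁ := div_pos (R.step_pos r) hβ
    have htle : R.step r / c.β₁ ≤ p.initialStep c.σ (R.x r) (R.V r) (R.dx r) (R.dV r) := by
      rw [htk]
      exact mul_le_of_le_one_right (p.initialStep_pos hσ _ _ _ _).le
        (pow_le_one₀ hβ.le c.β₁_mem.2.le)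
    obtain ⟨hFr, hVr⟩ := R.posDef r
    obtain ⟨hFt, hVt⟩ := p.posDef_of_le_initialStep c.σ_mem hFr hVr
      ((R.deltaV r).isSymm hFr hVr) ht0.le htle
    have hmer := p.merit_add_smul_le c.ν_pos.le (R.γ_pos r).le (R.direction r)
      (R.mulG_eq hA.x_zero r) hρ0.le (((le_max_left _ _).trans (R.max_le_ρ_succ r)).trans_eq hρr)
      ht0 (htle.trans (min_le_right _ _)) hFr hFt hVr hVt
    rw [hρr, Problem.Armijo, not_le] at hnot
    change _ - c.α * (R.step r / c.β₁) * R.decrease r + _ < _ at hnot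
    change _ ≤ _ + (R.step r / c.β₁) * (-R.decrease r + _ + _) at hmer
    have h1 : (R.step r / c.β₁) * ((1 - c.α) * R.decrease r) <
        (R.step r / c.β₁) * p.remainder c.ν ρ (R.x r) (R.V r) (R.dx r) (R.dV r)
          (R.step r / c.β₁) := by linarith
    have h2 := lt_of_mul_lt_mul_left h1 ht0.le
    linarith [mul_le_mul_of_nonneg_left hr hα.le]
  exact hfin.exists.elim fun _ h => h

theorem AssumptionA.tendsto_dx (hA : R.AssumptionA) (hB : R.AssumptionB) :
    Tendsto R.dx atTop (𝓝 0) := by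
  have hdec := hA.tendsto_decrease hB
  obtain ⟨η₁, η₂, hη, -, hBB⟩ := hB
  have h1 : Tendsto (fun r => R.decrease r / η₁) atTop (𝓝 0) := by simpa using hdec.div_const η₁
  have h2 : Tendsto (fun r => ‖R.dx r‖ ^ 2) atTop (𝓝 0) := by
    refine squeeze_zero (fun r => sq_nonneg _) (fun r => ?_) h1
    rw [le_div_iff₀ hη, mul_comm]
    refine (mul_norm_sq_le (hBB r).2).trans ?_
    unfold decrease
    nlinarith [hA.psiDeriv_nonpos r, c.ν_pos]
  have h3 := h2.sqrt
  rw [tendsto_zero_iff_norm_tendsto_zero]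
  simpa using h3

theorem AssumptionA.tendsto_psiDeriv (hA : R.AssumptionA) (hB : R.AssumptionB) :
    Tendsto (fun r => p.psiDeriv (R.x r) (R.V r) (R.dx r) (R.dV r)) atTop (𝓝 0) := by
  have h1 : Tendsto (fun r => -(R.decrease r / c.ν)) atTop (𝓝 0) := by
    simpa using ((hA.tendsto_decrease hB).div_const c.ν).neg
  refine tendsto_of_tendsto_of_tendsto_of_le_of_le h1 tendsto_const_nhds (fun r => ?_)
    (fun r => hA.psiDeriv_nonpos r)
  rw [neg_le, le_div_iff₀ c.ν_pos]
  have := dotProduct_mulVec_nonneg (R := R) r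
  unfold decrease
  linarith

/-- The matrices `B_r` are bounded, so `B_r Δx^r` tends to zero with `Δx^r`. -/
theorem AssumptionA.tendsto_mulVec_dx (hA : R.AssumptionA) (hB : R.AssumptionB) :
    Tendsto (fun r => (WithLp.toLp 2 (R.B r *ᵥ (R.dx r).ofLp) : Vec n)) atTop (𝓝 0) := by
  have hdx := hA.tendsto_dx hB
  obtain ⟨η₁, η₂, -, -, hBB⟩ := hB
  have hent : ∀ r i j, |R.B r i j| ≤ n * η₂ := fun r i j => by
    have h1 := (hBB r).1.trace_nonneg
    rw [trace_sub, trace_smul, trace_one, Fintype.card_fin, smul_eq_mul] at h1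
    linarith [(R.B_posDef r).posSemidef.abs_apply_le_trace i j]
  have hcoord : ∀ j, Tendsto (fun r => (R.dx r).ofLp j) atTop (𝓝 0) := fun j => by
    have : Continuous fun v : Vec n => v.ofLp j := by fun_prop
    simpa [Function.comp_def] using (this.tendsto 0).comp hdx
  have h : Tendsto (fun r => R.B r *ᵥ (R.dx r).ofLp) atTop (𝓝 0) := by
    refine tendsto_pi_nhds.2 fun i => ?_
    simp only [mulVec, dotProduct, Pi.zero_apply]
    rw [← Finset.sum_const_zero (s := (Finset.univ : Finset (Fin n)))]
    refine tendsto_finsetSum _ fun j _ => ?_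
    have h1 : Tendsto (fun r => n * η₂ * |(R.dx r).ofLp j|) atTop (𝓝 0) := by
      simpa using (hcoord j).abs.const_mul (n * η₂)
    refine squeeze_zero_norm (fun r => ?_) h1
    rw [norm_mul]
    exact mul_le_mul_of_nonneg_right (hent r i j) (norm_nonneg _)
  exact ((PiLp.continuous_toLp 2 _).tendsto 0).comp h

end Run

end SIPLOG

/-! ### Boundedness and accumulation points -/

namespace SIPLOG

open Matrix

theorem exists_forall_le_of_eventually_le {u : ℕ → ℝ} {C : ℝ} (h : ∀ᶠ r in atTop, u r ≤ C) :
    ∃ C', ∀ r, u r ≤ C' := by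
  obtain ⟨N, hN⟩ := eventually_atTop.1 h
  obtain ⟨C₀, hC₀⟩ := ((Set.finite_Iio N).image u).bddAbove
  refine ⟨max C C₀, fun r => ?_⟩
  rcases lt_or_ge r N with hr | hr
  · exact le_max_of_le_right (hC₀ ⟨r, hr, rfl⟩)
  · exact le_max_of_le_left (hN r hr)

theorem frobNorm_le_trace {m : ℕ} {V : Mat m} (hV : V.PosSemidef) :
    frobNorm V ≤ m * V.trace := by
  have h1 := hV.trace_mul_le hV
  rw [Fintype.card_fin] at h1
  rw [frobNorm, hV.isSymm.eq]
  refine Real.sqrt_le_iff.2 ⟨mul_nonneg (Nat.cast_nonneg m) hV.trace_nonneg, ?_⟩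
  linarith

/-- The functions `τ ↦ ∇ₓ g(x, τ)ᵀ v` as a map to `C(T)`. -/
noncomputable def Problem.innerGradG {n m s : ℕ} {T : Type*} [TopologicalSpace T]
    (p : Problem n m s T) (q : Vec n × Vec n) : C(T, ℝ) :=
  ⟨fun τ => inner ℝ (p.gradG q.1 τ) q.2, ((p.gradGMap q.1).continuous).inner continuous_const⟩

theorem Problem.continuous_innerGradG {n m s : ℕ} {T : Type*} [TopologicalSpace T]
    (p : Problem n m s T) : Continuous p.innerGradG := by
  have h : Continuous fun w : (Vec n × Vec n) × T => inner ℝ (p.gradG w.1.1 w.2) w.1.2 :=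
    (p.continuous_gradG.comp (by fun_prop : Continuous
      fun w : (Vec n × Vec n) × T => (w.1.1, w.2))).inner (by fun_prop)
  exact (ContinuousMap.curry ⟨_, h⟩).continuous

namespace Run

section

variable {n m s : ℕ} {T : Type*} [TopologicalSpace T] [MeasurableSpace T]
  {p : Problem n m s T} {c : Params} {R : Run p c}

theorem AssumptionA.exists_bound (hA : R.AssumptionA) :
    ∃ C : ℝ, ∀ r, ‖R.x r‖ ≤ C ∧ tvNorm (R.y r) ≤ C ∧ ‖R.z r‖ ≤ C ∧ frobNorm (R.V r) ≤ C := by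
  obtain ⟨Mx, hMx⟩ := hA.x_bdd
  obtain ⟨M, hM⟩ := hA.penalty_bdd
  obtain ⟨ε, -, Cv, hCv⟩ := hA.exists_det_trace_bounds
  have hmax : ∀ᶠ r in atTop, max (tvNorm (R.y r)) ‖R.z r‖ ≤ M := by
    filter_upwards [eventually_ge_atTop 1] with r hr
    obtain ⟨k, rfl⟩ := Nat.exists_eq_add_of_le' hr
    exact (R.max_le_ρ_succ k).trans ((le_abs_self _).trans (hM _))
  obtain ⟨C₁, hC₁⟩ := exists_forall_le_of_eventually_le hmax
  obtain ⟨C₂, hC₂⟩ := exists_forall_le_of_eventually_le (u := fun r => frobNorm (R.V r))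
    (C := m * Cv) (hCv.mono fun r hr => (frobNorm_le_trace (R.posDef r).2.posSemidef).trans
      (mul_le_mul_of_nonneg_left hr.2.2 (Nat.cast_nonneg m)))
  refine ⟨max Mx (max C₁ C₂), fun r => ⟨le_max_of_le_left (hMx r), ?_, ?_, ?_⟩⟩
  · exact le_max_of_le_right (le_max_of_le_left ((le_max_left _ _).trans (hC₁ r)))
  · exact le_max_of_le_right (le_max_of_le_left ((le_max_right _ _).trans (hC₁ r)))
  · exact le_max_of_le_right (le_max_of_le_right (hC₂ r))

end

variable {n m s : ℕ} {T : Type*} [MetricSpace T] [CompactSpace T] [MeasurableSpace T]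
  [BorelSpace T] {p : Problem n m s T} {c : Params} {R : Run p c}

/-- The limit of the primal-dual matrices along an ultrafilter satisfies `V = μ F(x)⁻¹`, because
the derivative of `ψ` vanishes in the limit. -/
theorem AssumptionA.limit_V_eq (hA : R.AssumptionA) (hB : R.AssumptionB) {U : Ultrafilter ℕ}
    (hU : (U : Filter ℕ) ≤ atTop) {x : Vec n} {V : Mat m} (hx : Tendsto R.x U (𝓝 x))
    (hV : Tendsto R.V U (𝓝 V)) (hF : (p.F x).PosDef) (hVp : V.PosDef) :
    V = p.mu • (p.F x)⁻¹ := by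
  have hFx : Tendsto (fun r => p.F (R.x r)) U (𝓝 (p.F x)) := (p.continuous_F.tendsto x).comp hx
  have hFi := tendsto_inv hFx hF.isUnit_det
  have hVi := tendsto_inv hV hVp.isUnit_det
  have hY := hV.sub (hFi.const_smul p.mu)
  have h1 := (tendsto_trace (((hFx.mul hY).mul hVi).mul hY)).neg
  have h2 : Tendsto (fun r => p.psiDeriv (R.x r) (R.V r) (R.dx r) (R.dV r)) U (𝓝 0) :=
    (hA.tendsto_psiDeriv hB).mono_left hU
  have h3 : (fun r => p.psiDeriv (R.x r) (R.V r) (R.dx r) (R.dV r)) = fun r => _ :=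
    funext fun r => Problem.psiDeriv_eq (R.posDef r).1 (R.posDef r).2 (R.P_isUnit r)
      (hA.scaling r) (R.deltaV r)
  rw [h3] at h2
  have h4 := neg_eq_zero.1 (tendsto_nhds_unique h1 h2)
  exact sub_eq_zero.1 (hF.eq_zero_of_trace_mul_mul_mul hVp.inv
    (hVp.isSymm.sub (hF.inv.isSymm.smul _)) h4)

theorem AssumptionA.isKKT_of_tendsto (hA : R.AssumptionA) (hB : R.AssumptionB) {U : Ultrafilter ℕ}
    (hU : (U : Filter ℕ) ≤ atTop) {x : Vec n} {y : SignedMeasure T} {z : Fin s → ℝ} {V : Mat m}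
    (hx : Tendsto R.x U (𝓝 x)) (hy : Tendsto (fun r => weakStar (R.y r)) U (𝓝 (weakStar y)))
    (hz : Tendsto R.z U (𝓝 z)) (hV : Tendsto R.V U (𝓝 V)) : p.IsKKT x y z V := by
  obtain ⟨x', V', hx', hV', hF, hVp⟩ := hA.exists_limit hU
  obtain rfl := tendsto_nhds_unique hx hx'
  obtain rfl := tendsto_nhds_unique hV hV'
  have hVeq := hA.limit_V_eq hB hU hx hV hF hVp
  have hyr : ∀ᶠ r in (U : Filter ℕ), 0 ≤ R.y r := by
    filter_upwards [hU (eventually_ge_atTop 1)] with r hr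
    obtain ⟨k, rfl⟩ := Nat.exists_eq_add_of_le' hr
    exact (R.direction k).y_supp.1
  have hy0 : 0 ≤ y := nonneg_of_weakStar_nonneg fun φ hφ => by
    refine ge_of_tendsto (tendsto_pi_nhds.1 hy φ) (hyr.mono fun r hr => ?_)
    obtain ⟨μ, _, hμ⟩ := exists_measure_of_nonneg hr
    rw [← hμ, weakStar, VectorMeasure.integral_toSignedMeasure]
    exact integral_nonneg hφ
  -- the multipliers at index `r` belong to the quadratic program at the iterate `r - 1`
  have hpred : Tendsto (fun r => r - 1) (U : Filter ℕ) atTop :=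
    (tendsto_sub_atTop_nat 1).mono_left hU
  have hd : Tendsto (fun r => R.dx (r - 1)) U (𝓝 0) := (hA.tendsto_dx hB).comp hpred
  have hBd := (hA.tendsto_mulVec_dx hB).comp hpred
  have hγ : Tendsto (fun r => R.γ (r - 1)) U (𝓝 0) := R.tendsto_γ.comp hpred
  have hxp : Tendsto (fun r => R.x (r - 1)) U (𝓝 x) := by
    have hsd : Tendsto (fun r => R.step (r - 1) • R.dx (r - 1)) U (𝓝 0) := by
      refine squeeze_zero_norm (fun r => ?_) (tendsto_zero_iff_norm_tendsto_zero.1 hd)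
      rw [norm_smul, Real.norm_of_nonneg (R.step_pos _).le]
      exact mul_le_of_le_one_left (norm_nonneg _) (R.step_le_one _)
    have h1 := hx.sub hsd
    rw [sub_zero] at h1
    refine h1.congr' ?_
    filter_upwards [hU (eventually_ge_atTop 1)] with r hr
    obtain ⟨k, rfl⟩ := Nat.exists_eq_add_of_le' hr
    rw [R.x_succ, Nat.add_sub_cancel, add_sub_cancel_right]
  have hdir : ∀ᶠ r in (U : Filter ℕ),
      p.IsDirection (R.x (r - 1)) (R.B (r - 1)) (R.γ (r - 1)) (R.dx (r - 1)) (R.y r) (R.z r) := by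
    filter_upwards [hU (eventually_ge_atTop 1)] with r hr
    obtain ⟨k, rfl⟩ := Nat.exists_eq_add_of_le' hr
    exact R.direction k
  have hlin : Tendsto (fun r => p.gMap (R.x (r - 1)) + p.innerGradG (R.x (r - 1), R.dx (r - 1))) U
      (𝓝 (p.gMap x)) := by
    have h1 := ((p.continuous_gMap.tendsto x).comp hxp).add
      ((p.continuous_innerGradG.tendsto (x, 0)).comp (hxp.prodMk_nhds hd))
    have h2 : p.innerGradG (x, 0) = 0 := by
      ext τ
      exact inner_zero_right (𝕜 := ℝ) (p.gradG x τ)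
    rwa [h2, add_zero] at h1
  have hFi := tendsto_inv ((p.continuous_F.tendsto x).comp hxp) hF.isUnit_det
  have hbar : p.F x * V = p.mu • (1 : Mat m) := by
    rw [hVeq, Matrix.mul_smul, mul_nonsing_inv _ hF.isUnit_det]
  have hbar' : V * p.F x = p.mu • (1 : Mat m) := by
    rw [hVeq, Matrix.smul_mul, nonsing_inv_mul _ hF.isUnit_det]
  refine ⟨?_, ?_, hF, hVp, ?_, fun τ => ?_, hy0, ?_⟩
  · have hxi : p.adjF V = p.mu • p.adjF (p.F x)⁻¹ := by
      rw [hVeq]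
      ext i
      simp [Problem.adjF, inn]
    refine ext_inner_right ℝ fun v => ?_
    have hpair : ∀ (x' : Vec n) {y' : SignedMeasure T}, 0 ≤ y' →
        inner ℝ (∫ᵛ τ, p.gradG x' τ ∂<•y') v = weakStar y' (p.innerGradG (x', v)) :=
      fun x' _ hy' => inner_vectorIntegral hy' (p.gradGMap x') v
    rw [hxi, inner_zero_left, inner_add_left, inner_sub_left, inner_add_left, hpair x hy0]
    have h1 := ((p.continuous_gradient_f.tendsto x).comp hxp).inner
      (tendsto_const_nhds (x := v)) (𝕜 := ℝ)
    have h2 := hBd.inner (tendsto_const_nhds (x := v)) (𝕜 := ℝ)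
    have h3 := (((p.continuous_adjF.tendsto _).comp hFi).const_smul p.mu).inner
      (tendsto_const_nhds (x := v)) (𝕜 := ℝ)
    have h4 := tendsto_integral_of_weakStar hyr hy
      ((p.continuous_innerGradG.tendsto (x, v)).comp (hxp.prodMk_nhds tendsto_const_nhds))
    have h5 := ((p.continuous_mulGT.tendsto z).comp hz).inner
      (tendsto_const_nhds (x := v)) (𝕜 := ℝ)
    have hsum := (((h1.add h2).sub h3).add h4).add h5
    have hzero := tendsto_nhds_unique (hsum.congr' (f₂ := fun _ => (0 : ℝ)) (by
      filter_upwards [hdir, hyr] with r hr hyr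
      have hst := congrArg (fun w => inner ℝ w v) hr.stationarity
      simp only [inner_add_left, inner_sub_left, inner_zero_left] at hst
      rw [hpair _ hyr] at hst
      exact hst)) tendsto_const_nhds
    rw [inner_zero_left, add_zero] at hzero
    change inner ℝ (gradient p.f x) v - inner ℝ (p.mu • p.adjF (p.F x)⁻¹) v +
      weakStar y (p.innerGradG (x, v)) + inner ℝ (p.mulGT z) v = 0 at hzero
    linarith
  · rw [jordan, hbar, hbar', ← two_smul ℝ, smul_smul]
    norm_num
  · have h1 := tendsto_integral_of_weakStar hyr hy hlin
    refine tendsto_nhds_unique (h1.congr' (f₂ := fun _ => (0 : ℝ)) ?_) tendsto_const_nhds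
    exact hdir.mono fun r hr => hr.complementarity
  · have h1 : Tendsto (fun r => p.linG (R.x (r - 1)) (R.dx (r - 1)) τ) U (𝓝 (p.g x τ)) :=
      ((ContinuousEvalConst.continuous_eval_const τ).tendsto (p.gMap x)).comp hlin
    exact le_of_tendsto_of_tendsto h1 hγ
      (hdir.mono fun r hr => (le_max_left _ _).trans (hr.relaxed τ))
  · exact tendsto_nhds_unique ((p.continuous_mulG.tendsto x).comp hx)
      (tendsto_const_nhds.congr fun r => (R.mulG_eq hA.x_zero r).symm)

end Run

end SIPLOG

theorem mainTheorem1 {n m s : ℕ} {T : Type*} [MetricSpace T] [CompactSpace T]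
    [MeasurableSpace T] [BorelSpace T]
    (p : SIPLOG.Problem n m s T) (hSlater : p.HasSlaterPoint)
    (c : SIPLOG.Params) (R : SIPLOG.Run p c)
    (hA : R.AssumptionA) (hB : R.AssumptionB) :
    (∃ C : ℝ, ∀ r, ‖R.x r‖ ≤ C ∧ SIPLOG.tvNorm (R.y r) ≤ C ∧ ‖R.z r‖ ≤ C ∧
      SIPLOG.frobNorm (R.V r) ≤ C) ∧
    ∀ (x : SIPLOG.Vec n) (y : SignedMeasure T) (z : Fin s → ℝ) (V : SIPLOG.Mat m),
      MapClusterPt (x, SIPLOG.weakStar y, z, V) atTop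
        (fun r => (R.x r, SIPLOG.weakStar (R.y r), R.z r, R.V r)) →
      p.IsKKT x y z V := by
  refine ⟨hA.exists_bound, fun x y z V h => ?_⟩
  obtain ⟨U, hU, hlim⟩ := mapClusterPt_iff_ultrafilter.1 h
  exact hA.isKKT_of_tendsto hB hU (continuous_fst.continuousAt.tendsto.comp hlim)
    ((continuous_fst.comp continuous_snd).continuousAt.tendsto.comp hlim)
    ((continuous_fst.comp (continuous_snd.comp continuous_snd)).continuousAt.tendsto.comp hlim)
    ((continuous_snd.comp (continuous_snd.comp continuous_snd)).continuousAt.tendsto.comp hlim)
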